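/- Let $\mathbb K=\mathbb R$ or $\mathbb C$. Let $\mathcal S(\mathbb R)$ be the space of $\mathbb K$-valued Schwartz functions on $\mathbb R$, and let $\mathcal O_M(\mathbb R)$ be the space of smooth functions $h:\mathbb R\to\mathbb K$ which, together with all their derivatives, are polynomially bounded. For $f\in\mathcal S(\mathbb R)$ put $$\mathcal V_f=\{hf' : h\in\mathcal O_M(\mathbb R)\}\subset\mathcal S(\mathbb R),\qquad \lambda(p)=p+\mathrm{p.v.}\!\int_{\mathbb R}\frac{f(q)}{p-q}\,dq .$$ Consider the kernels $$c\tbinom{p}{q\,r}=\frac{\delta(p-r)}{p-q}-\frac{f'(p)}{f'(q)}\frac{\delta(q-r)}{p-q}+\frac{\delta(p-q)}{q-r}-\frac{\lambda'(p)}{f'(p)}\,\delta(q-r)\,\delta(q-p),$$ $$\eta_{(p\,q)}=-\frac{\delta(p-q)}{f'(p)},\qquad \Gamma\tbinom{p}{q\,r}=\frac{1}{f'(q)}\,\delta'(q-p)\,\delta(q-r),$$ where $\frac1{p-q}$ and $\frac1{q-r}$ are understood as principal values, and the kernels are understood through their action on vectors of $\mathcal V_f$. Explicitly, for $X,Y,Z\in\mathcal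 V_f$, with $\int\Phi(q)\,\delta'(p-q)\,dq=\Phi'(p)$, $$(X\circ Y)(p)=\iint X(q)\,c\tbinom{p}{q\,r}\,Y(r)\,dq\,dr$$ $$=Y(p)\,\mathrm{p.v.}\!\!\int\!\frac{X(q)}{p-q}dq-f'(p)\,\mathrm{p.v.}\!\!\int\!\frac{X(q)Y(q)}{f'(q)}\frac{dq}{p-q}+X(p)\,\mathrm{p.v.}\!\!\int\!\frac{Y(r)}{p-r}dr-\lambda'(p)\frac{X(p)Y(p)}{f'(p)},$$ $$\eta(X,Y)=-\int\frac{X(p)Y(p)}{f'(p)}\,dp,\qquad \Gamma(Z,X)(p)=\iint\Gamma\tbinom{p}{q\,r}Z(q)X(r)\,dq\,dr=-\frac{d}{dp}\left(\frac{Z(p)X(p)}{f'(p)}\right),$$ where for $X=hf'$, $Y=kf'$ the quotient $XY/f'$ means $hkf'$ (this does not depend on the choice of $h,k$). A vector field $\mathbf X$ differentiable at $f$ is a map $g\mapsto \mathbf X[g]=h[g]\,g'\in\mathcal V_g$ on $\mathcal S(\mathbb R)$, with $h[g]\in\mathcal O_M(\mathbb R)$, such that for every $Z\in\mathcal V_f$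 the difference quotients $(h[f+\varepsilon Z]-h[f])/\varepsilon$ converge as $\varepsilon\to0$ to an element of $\mathcal O_M(\mathbb R)$, each $p$-derivative converging uniformly with respect to some polynomial weight. Its covariant derivative at $f$ along $Z\in\mathcal V_f$ is $$\nabla_Z\mathbf X=\left.\frac{d}{d\varepsilon}\right|_{\varepsilon=0}\mathbf X[f+\varepsilon Z]+\Gamma(Z,\mathbf X[f]),\qquad\text{i.e.}\quad \nabla_{(l)}X^{(p)}=\frac{\delta X^{(p)}}{\delta f(l)}+\int\Gamma\tbinom{p}{l\,r}X^{(r)}dr,$$ and the covariant derivative of $c$, paired with vector fields, is given by the Leibniz rule $$(\nabla_Zc)(\mathbf X,\mathbf Y)=\iiint Z(l)\,X(q)\,\nabla_{(l)}c\tbinom{p}{q\,r}\,Y(r)\,dl\,dq\,dr=\nabla_Z(\mathbf X\circ\mathbf Y)-(\nabla_Z\mathbf X)\circ\mathbf Y-\mathbf X\circ(\nabla_Z\mathbf Y).$$ **Theorem.** Let $f\in\mathcal S(\mathbb R)$. Then $\lambda$ is differentiable, all the principal values and integrals above exist for $X,Y\in\mathcal V_f$, and $\circ$ is a $\mathbb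 K$-bilinear product $\mathcal V_f\times\mathcal V_f\to\mathcal V_f$. For all $X,Y,Z\in\mathcal V_f$: 1. (symmetry) $X\circ Y=Y\circ X$, that is, $c\binom{p}{q\,r}=c\binom{p}{r\,q}$; 2. (associativity) $(X\circ Y)\circ Z=X\circ(Y\circ Z)$ and $X\circ(Y\circ Z)=Y\circ(X\circ Z)$, that is, $\int c\binom{p}{q\,s}c\binom{s}{l\,r}ds=\int c\binom{p}{l\,s}c\binom{s}{q\,r}ds$; 3. (compatibility with the metric) $\eta(X,Y\circ Z)=\eta(Y,X\circ Z)$, that is, $\int\eta_{(p\,q)}c\binom{q}{r\,s}dq=\int\eta_{(r\,q)}c\binom{q}{p\,s}dq$. Moreover: 4. (compatibility with the connection) for all vector fields $\mathbf X,\mathbf Y,\mathbf Z$ differentiable at $f$, the derivatives at $\varepsilon=0$ of $\mathbf X[f+\varepsilon\mathbf Z[f]](p)$ and $(\mathbf X\circ\mathbf Y)[f+\varepsilon\mathbf Z[f]](p)$ exist for every $p$, $\nabla_{\mathbf Z[f]}\mathbf X\in\mathcal V_f$, and $$(\nabla_{\mathbf Z[f]}c)(\mathbf X,\mathbf Y)=(\nabla_{\mathbf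 X[f]}c)(\mathbf Z,\mathbf Y)\quad\text{at } f,$$ that is, $\nabla_{(l)}c\binom{p}{q\,r}=\nabla_{(q)}c\binom{p}{l\,r}$. -/

import Mathlib

open Filter Topology MeasureTheory SchwartzMap

noncomputable section

namespace DKP

variable {𝕜 : Type*} [RCLike 𝕜]

/-- The truncated integrals `∫_{|p-q|>δ} Φ(q)/(p-q) dq`. -/
def pvTrunc (Φ : ℝ → 𝕜) (p δ : ℝ) : 𝕜 :=
  ∫ q in {q : ℝ | δ < |p - q|}, Φ q / ((p - q : ℝ) : 𝕜)

/-- The Cauchy principal value `p.v. ∫ Φ(q)/(p-q) dq` exists and equals `v`. -/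
def HasPV (Φ : ℝ → 𝕜) (p : ℝ) (v : 𝕜) : Prop :=
  Tendsto (pvTrunc Φ p) (𝓝[>] 0) (𝓝 v)

/-- The distribution `p.v. 1/(p-q)` in the variable `q`, paired with `Φ(q)`. -/
def pv (Φ : ℝ → 𝕜) (p : ℝ) : 𝕜 :=
  limUnder (𝓝[>] 0) (pvTrunc Φ p)

/-- The distribution `δ(p-q)` in the variable `q`, paired with `Φ(q)`. -/
def delta (Φ : ℝ → 𝕜) (p : ℝ) : 𝕜 := Φ p

/-- The distribution `δ'(p-q)` in the variable `q`, paired with `Φ(q)`; thus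
`δ'(q-p) = -δ'(p-q)` is paired with `Φ(q)` to give `-Φ'(p)`. -/
def delta' (Φ : ℝ → 𝕜) (p : ℝ) : 𝕜 := deriv Φ p

/-- `λ(p) = p + p.v. ∫ f(q)/(p-q) dq`. -/
def lam (f : 𝓢(ℝ, 𝕜)) (p : ℝ) : 𝕜 := (p : 𝕜) + pv f p

/-- The space `V = {h f' : h ∈ O_M(ℝ)}`, where `O_M(ℝ)` is the space of smooth functions all of
whose derivatives are polynomially bounded (`Function.HasTemperateGrowth`). -/
def V (f : 𝓢(ℝ, 𝕜)) : Submodule 𝕜 𝓢(ℝ, 𝕜) where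
  carrier := {X | ∃ h : ℝ → 𝕜, Function.HasTemperateGrowth h ∧ ∀ p, X p = h p * deriv f p}
  add_mem' := by
    rintro X Y ⟨h, hh, hX⟩ ⟨k, hk, hY⟩
    refine ⟨h + k, hh.add hk, fun p => ?_⟩
    rw [_root_.add_apply, hX, hY, Pi.add_apply, add_mul]
  zero_mem' := ⟨fun _ => 0, Function.HasTemperateGrowth.const 0, fun p => by simp⟩
  smul_mem' := by
    rintro a X ⟨h, hh, hX⟩
    refine ⟨fun p => a * h p, (Function.HasTemperateGrowth.const a).mul hh, fun p => ?_⟩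
    rw [_root_.smul_apply, hX, smul_eq_mul, mul_assoc]

/-- The pairing `∬ X(q) c(p;q,r) Y(r) dq dr` of the kernel
`c(p;q,r) = δ(p-r)/(p-q) - (f'(p)/f'(q)) δ(q-r)/(p-q) + δ(p-q)/(q-r) - (λ'(p)/f'(p)) δ(q-r) δ(q-p)`
with `X` and `Y`, term by term.  For `X = h f'` and `Y = k f'` the quotient `X Y / f'` is the
function `h k f'`, also at the zeros of `f'`, where Lean's convention `0 / 0 = 0` gives the
right value. -/
def cPair (f : 𝓢(ℝ, 𝕜)) (p : ℝ) (X Y : ℝ → 𝕜) : 𝕜 :=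
  pv X p * delta Y p
    - deriv f p * pv (fun q => X q * Y q / deriv f q) p
    + delta X p * pv Y p
    - delta (fun q => deriv (lam f) q * (X q * Y q / deriv f q)) p

/-- The bilinear form `∬ X(p) η_(p,q) Y(q) dp dq`, `η_(p,q) = -δ(p-q)/f'(p)`. -/
def metric (f : 𝓢(ℝ, 𝕜)) (X Y : ℝ → 𝕜) : 𝕜 :=
  -∫ p, X p * delta Y p / deriv f p

/-- The pairing `∬ Γ(p;q,r) Z(q) X(r) dq dr` of the Christoffel symbols
`Γ(p;q,r) = (1/f'(q)) δ'(q-p) δ(q-r)` with `Z` and `X`. -/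
def christoffel (f : 𝓢(ℝ, 𝕜)) (Z X : ℝ → 𝕜) (p : ℝ) : 𝕜 :=
  -delta' (fun q => Z q * delta X q / deriv f q) p

/-- The variational derivative `∫ (δX(p)/δf(l)) Z(l) dl` of a functional `X` of `f`. -/
def varDeriv (X : 𝓢(ℝ, 𝕜) → ℝ → 𝕜) (f Z : 𝓢(ℝ, 𝕜)) (p : ℝ) : 𝕜 :=
  deriv (fun ε : ℝ => X (f + ε • Z) p) 0

/-- The covariant derivative `∫ Z(l) ∇_(l) X(p) dl` of a vector field `X` at `f`, with
`∇_(l) X(p) = δX(p)/δf(l) + ∫ Γ(p;l,r) X(r) dr`. -/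
def covDeriv (X : 𝓢(ℝ, 𝕜) → ℝ → 𝕜) (f Z : 𝓢(ℝ, 𝕜)) (p : ℝ) : 𝕜 :=
  varDeriv X f Z p + christoffel f Z (X f) p

/-- The product of two vector fields. -/
def prodField (X Y : 𝓢(ℝ, 𝕜) → 𝓢(ℝ, 𝕜)) : 𝓢(ℝ, 𝕜) → ℝ → 𝕜 :=
  fun g p => cPair g p (X g) (Y g)

/-- The covariant derivative of the tensor field `c`, paired with vector fields: the value at `f`
of `∭ Z(l) X(q) (∇_(l) c(p;q,r)) Y(r) dl dq dr`, that is
`(∇_Z c)(X, Y) = ∇_Z (X ∘ Y) - (∇_Z X) ∘ Y - X ∘ (∇_Z Y)`. -/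
def covDerivC (X Y : 𝓢(ℝ, 𝕜) → 𝓢(ℝ, 𝕜)) (f Z : 𝓢(ℝ, 𝕜)) (p : ℝ) : 𝕜 :=
  covDeriv (prodField X Y) f Z p
    - cPair f p (covDeriv (fun g => X g) f Z) (Y f)
    - cPair f p (X f) (covDeriv (fun g => Y g) f Z)

/-- The curve `ε ↦ h ε` in `O_M(ℝ)` has derivative `h'` at `ε = 0`: for every order `n`, the `n`-th
derivative of the difference quotient converges uniformly with respect to some polynomial
weight. -/
def HasOMDeriv (h : ℝ → ℝ → 𝕜) (h' : ℝ → 𝕜) : Prop :=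
  ∀ n : ℕ, ∃ N : ℕ, ∀ a : ℝ, 0 < a → ∀ᶠ ε in 𝓝[≠] (0 : ℝ), ∀ p : ℝ,
    ‖iteratedDeriv n (fun q => ε⁻¹ • (h ε q - h 0 q) - h' q) p‖ ≤ a * (1 + |p|) ^ N

/-- `X` is a vector field with values `X(g) = h(g) g' ∈ V(g)`, `h(g) ∈ O_M(ℝ)`, whose coefficient
`h` is differentiable at the point `f` in all directions of `V(f)`. -/
def IsVectorFieldAt (X : 𝓢(ℝ, 𝕜) → 𝓢(ℝ, 𝕜)) (f : 𝓢(ℝ, 𝕜)) : Prop :=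
  ∃ h : 𝓢(ℝ, 𝕜) → ℝ → 𝕜,
    (∀ g, Function.HasTemperateGrowth (h g)) ∧
    (∀ g p, X g p = h g p * deriv g p) ∧
    ∀ Z ∈ V f, ∃ h' : ℝ → 𝕜, Function.HasTemperateGrowth h' ∧
      HasOMDeriv (fun ε => h (f + ε • Z)) h'

end DKP

end

noncomputable section

namespace DKP

variable {𝕜 : Type*} [RCLike 𝕜]

/-! ### The principal value of a Schwartz function -/

/-! Everything is done on coefficients: for `X = h f'` and `Y = k f'` the product is `coefProd f h
k` times `f'`. Substituting `t = p - q` and folding the two half-lines turns the principal value of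
a Schwartz function into an absolutely convergent integral of `pvKer`. Its bound is linear in a
weighted C¹ bound of the function (`norm_pv_le`), so `pv` commutes with differentiation in `p`, has
temperate growth, and is continuous along curves.

The algebra rests on `coefProd_eq_integral`: since λ' = 1 + pv f', the singular terms combine and
the coefficient of the product becomes -h(p)k(p) - ∫ (h(p)-h(q))(k(p)-k(q))/(p-q) f'(q) dq, with no
singularity left. Associativity and invariance of the metric then reduce to pointwise identities
between kernels. The double integrals are taken against the symmetric weight f'(q)f'(s), so only the
symmetrization of a kernel in its two variables matters (`integral_integral_of_add_swap_eq`).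

For the connection, the Christoffel term changes the derivative h' of a coefficient along ζ f' into
h' - ζ ∂h (`covDeriv_eq`). In ∇c every variation of the fields cancels. There remains `covCoef`, the
expansion of (h(p)-h(q))(k(p)-k(q))(ζ(p)-ζ(q)) with each function of q replaced by the principal
value of the derivative of that function times f'. This is visibly symmetric. -/

/-- The integrand of the symmetrized form of the principal value. -/
def pvKer (Φ : ℝ → 𝕜) (p t : ℝ) : 𝕜 := (Φ (p - t) - Φ (p + t)) / (t : 𝕜)

/-- A Peetre inequality: it trades decay at the shifted point for decay in `t`, at the cost of a
weight in `p`. -/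
theorem one_add_sq_le_peetre (p t : ℝ) : 1 + t ^ 2 ≤ 2 * (1 + p ^ 2) * (1 + (p - t) ^ 2) := by
  nlinarith [sq_nonneg (p - (p - t) * 1), sq_nonneg (2 * p - t), sq_nonneg (p * (p - t))]

theorem norm_sub_le_of_norm_deriv_le {ψ : ℝ → 𝕜} {A : ℝ} (hψ : Differentiable ℝ ψ)
    (hA : ∀ x, ‖deriv ψ x‖ ≤ A) (x y : ℝ) : ‖ψ y - ψ x‖ ≤ A * |y - x| :=
  Convex.norm_image_sub_le_of_norm_deriv_le (s := Set.univ) (fun x _ => hψ x) (fun x _ => hA x)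
    convex_univ (Set.mem_univ x) (Set.mem_univ y)

/-- For `t ≤ 1` the mean value theorem absorbs the singularity at `t = 0`; for `t ≥ 1` decay of `ψ`
and Peetre's inequality suffice. The bound is linear in `A` and quadratic in `p`: the first gives
continuity of `pv` in its argument, the second its polynomial growth. -/
theorem norm_pvKer_le {ψ : ℝ → 𝕜} {A : ℝ} (hψ : Differentiable ℝ ψ)
    (h0 : ∀ x, (1 + x ^ 2) * ‖ψ x‖ ≤ A) (h1 : ∀ x, ‖deriv ψ x‖ ≤ A) (p : ℝ) {t : ℝ} (ht : 0 < t) :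
    ‖pvKer ψ p t‖ ≤ 4 * A * (1 + p ^ 2) * (1 + t ^ 2)⁻¹ := by
  have hA : 0 ≤ A := (norm_nonneg _).trans (h1 0)
  rw [pvKer, norm_div, RCLike.norm_ofReal, abs_of_pos ht, div_le_iff₀ ht, ← div_eq_mul_inv,
    div_mul_eq_mul_div, le_div_iff₀ (by positivity)]
  rcases le_total t 1 with h | h
  · have := norm_sub_le_of_norm_deriv_le hψ h1 (p + t) (p - t)
    rw [show p - t - (p + t) = -(2 * t) by ring, abs_neg, abs_of_pos (by positivity)] at this
    calc ‖ψ (p - t) - ψ (p + t)‖ * (1 + t ^ 2) ≤ (A * (2 * t)) * 2 := by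
          gcongr; nlinarith
      _ = 4 * A * 1 * t := by ring
      _ ≤ _ := by gcongr; nlinarith [sq_nonneg p]
  · have e1 : ‖ψ (p - t)‖ * (1 + t ^ 2) ≤ 2 * (1 + p ^ 2) * A :=
      calc ‖ψ (p - t)‖ * (1 + t ^ 2) ≤ ‖ψ (p - t)‖ * (2 * (1 + p ^ 2) * (1 + (p - t) ^ 2)) := by
            gcongr; exact one_add_sq_le_peetre p t
        _ = 2 * (1 + p ^ 2) * ((1 + (p - t) ^ 2) * ‖ψ (p - t)‖) := by ring
        _ ≤ _ := by gcongr; exact h0 _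
    have e2 : ‖ψ (p + t)‖ * (1 + t ^ 2) ≤ 2 * (1 + p ^ 2) * A :=
      calc ‖ψ (p + t)‖ * (1 + t ^ 2) ≤ ‖ψ (p + t)‖ * (2 * (1 + p ^ 2) * (1 + (p + t) ^ 2)) := by
            gcongr; simpa using one_add_sq_le_peetre p (-t)
        _ = 2 * (1 + p ^ 2) * ((1 + (p + t) ^ 2) * ‖ψ (p + t)‖) := by ring
        _ ≤ _ := by gcongr; exact h0 _
    calc ‖ψ (p - t) - ψ (p + t)‖ * (1 + t ^ 2) ≤ (‖ψ (p - t)‖ + ‖ψ (p + t)‖) * (1 + t ^ 2) := by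
          gcongr; exact norm_sub_le _ _
      _ ≤ 4 * A * (1 + p ^ 2) * 1 := by linarith
      _ ≤ _ := by gcongr

theorem measurable_pvKer {ψ : ℝ → 𝕜} (hψ : Differentiable ℝ ψ) (p : ℝ) :
    Measurable (pvKer ψ p) := by
  have := hψ.continuous.measurable
  unfold pvKer
  fun_prop

theorem integrableOn_pvKer {ψ : ℝ → 𝕜} {A : ℝ} (hψ : Differentiable ℝ ψ)
    (h0 : ∀ x, (1 + x ^ 2) * ‖ψ x‖ ≤ A) (h1 : ∀ x, ‖deriv ψ x‖ ≤ A) (p : ℝ) :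
    IntegrableOn (pvKer ψ p) (Set.Ioi 0) := by
  refine Integrable.mono' ((integrable_inv_one_add_sq.const_mul (4 * A * (1 + p ^ 2))).integrableOn)
    (measurable_pvKer hψ p).aestronglyMeasurable ?_
  exact (ae_restrict_mem measurableSet_Ioi).mono fun t ht => norm_pvKer_le hψ h0 h1 p ht

theorem norm_integral_pvKer_le {ψ : ℝ → 𝕜} {A : ℝ} (hψ : Differentiable ℝ ψ)
    (h0 : ∀ x, (1 + x ^ 2) * ‖ψ x‖ ≤ A) (h1 : ∀ x, ‖deriv ψ x‖ ≤ A) (p : ℝ) :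
    ‖∫ t in Set.Ioi 0, pvKer ψ p t‖ ≤ 4 * A * (1 + p ^ 2) * Real.pi := by
  have hA : 0 ≤ A := (norm_nonneg _).trans (h1 0)
  have hi := integrable_inv_one_add_sq.const_mul (4 * A * (1 + p ^ 2))
  calc ‖∫ t in Set.Ioi 0, pvKer ψ p t‖
      ≤ ∫ t in Set.Ioi 0, 4 * A * (1 + p ^ 2) * (1 + t ^ 2)⁻¹ :=
        norm_integral_le_of_norm_le hi.integrableOn
          ((ae_restrict_mem measurableSet_Ioi).mono fun t ht => norm_pvKer_le hψ h0 h1 p ht)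
    _ ≤ ∫ t, 4 * A * (1 + p ^ 2) * (1 + t ^ 2)⁻¹ :=
        setIntegral_le_integral hi (ae_of_all _ fun t => by positivity)
    _ = _ := by rw [integral_const_mul, integral_univ_inv_one_add_sq]

/-- The substitution `t = p - q` and reflection of the negative half-line. Away from the singularity
each half is integrable separately. -/
theorem pvTrunc_eq {Φ : ℝ → 𝕜} (hΦ : Integrable Φ) (p : ℝ) {δ : ℝ} (hδ : 0 < δ) :
    pvTrunc Φ p δ = ∫ t in Set.Ioi δ, pvKer Φ p t := by
  have hmeas : MeasurableSet {t : ℝ | δ < |t|} := measurableSet_lt (by fun_prop) (by fun_prop)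
  have hmeas' : MeasurableSet {q : ℝ | δ < |p - q|} := measurableSet_lt (by fun_prop) (by fun_prop)
  have hintg (Ψ : ℝ → 𝕜) (hc : Integrable Ψ) :
      IntegrableOn (fun t : ℝ => Ψ t / (t : 𝕜)) {t : ℝ | δ < |t|} := by
    refine Integrable.mono' (hc.norm.const_mul δ⁻¹).integrableOn ?_ ?_
    · refine (hc.aestronglyMeasurable.aemeasurable.div ?_).aestronglyMeasurable.restrict
      fun_prop
    · refine (ae_restrict_mem hmeas).mono fun t (ht : δ < |t|) => ?_
      rw [norm_div, RCLike.norm_ofReal, div_eq_inv_mul]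
      gcongr
  have hint := hintg _ (hΦ.comp_sub_left p)
  have hint' := hintg _ (hΦ.comp_add_left p)
  have hset : {t : ℝ | δ < |t|} = Set.Ioi δ ∪ Set.Iio (-δ) := by
    ext t
    simp only [Set.mem_ofPred_eq, lt_abs, Set.mem_union, Set.mem_Ioi, Set.mem_Iio]
    constructor <;> rintro (h | h) <;> first | (left; linarith) | (right; linarith)
  have hdisj : Disjoint (Set.Ioi δ) (Set.Iio (-δ)) :=
    Set.disjoint_left.2 fun t h h' => by
      simp only [Set.mem_Ioi, Set.mem_Iio] at h h'; linarith
  calc pvTrunc Φ p δ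
      = ∫ q, {q : ℝ | δ < |p - q|}.indicator (fun q => Φ q / ((p - q : ℝ) : 𝕜)) q := by
        rw [integral_indicator hmeas', pvTrunc]
    _ = ∫ t, {q : ℝ | δ < |p - q|}.indicator (fun q => Φ q / ((p - q : ℝ) : 𝕜)) (p - t) :=
        (integral_sub_left_eq_self _ volume p).symm
    _ = ∫ t, {t : ℝ | δ < |t|}.indicator (fun t => Φ (p - t) / (t : 𝕜)) t := by
        congr 1 with t
        simp [Set.indicator]
    _ = ∫ t in {t : ℝ | δ < |t|}, Φ (p - t) / (t : 𝕜) := integral_indicator hmeas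
    _ = (∫ t in Set.Ioi δ, Φ (p - t) / (t : 𝕜)) + ∫ t in Set.Iio (-δ), Φ (p - t) / (t : 𝕜) := by
        rw [hset] at hint ⊢
        exact setIntegral_union hdisj measurableSet_Iio hint.left_of_union hint.right_of_union
    _ = (∫ t in Set.Ioi δ, Φ (p - t) / (t : 𝕜))
          + ∫ t in Set.Ioi δ, Φ (p - -t) / ((-t : ℝ) : 𝕜) := by
        rw [← integral_Iic_eq_integral_Iio,
          integral_comp_neg_Ioi δ (fun t => Φ (p - t) / (t : 𝕜))]
    _ = _ := by
        rw [hset] at hint hint'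
        have h2 : IntegrableOn (fun t : ℝ => Φ (p - -t) / ((-t : ℝ) : 𝕜)) (Set.Ioi δ) :=
          hint'.left_of_union.neg.congr (ae_of_all _ fun t => by simp [div_neg])
        rw [← integral_add hint.left_of_union h2]
        congr 1 with t
        simp only [pvKer, sub_neg_eq_add, RCLike.ofReal_neg, div_neg, sub_div]
        ring

theorem exists_bound (Φ : 𝓢(ℝ, 𝕜)) :
    ∃ A, (∀ x, (1 + x ^ 2) * ‖Φ x‖ ≤ A) ∧ ∀ x, ‖deriv Φ x‖ ≤ A := by
  obtain ⟨C₀, -, h₀⟩ := Φ.decay 0 0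
  obtain ⟨C₂, -, h₂⟩ := Φ.decay 2 0
  obtain ⟨C₁, -, h₁⟩ := (derivCLM 𝕜 𝕜 Φ).decay 0 0
  simp only [pow_zero, norm_iteratedFDeriv_zero, one_mul, Real.norm_eq_abs, sq_abs,
    derivCLM_apply] at h₀ h₁ h₂
  refine ⟨max (C₀ + C₂) C₁, fun x => le_max_of_le_left ?_, fun x => le_max_of_le_right (h₁ x)⟩
  linarith [h₀ x, h₂ x]

theorem integrableOn_pvKer_schwartz (Φ : 𝓢(ℝ, 𝕜)) (p : ℝ) :
    IntegrableOn (pvKer Φ p) (Set.Ioi 0) :=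
  let ⟨_, h0, h1⟩ := exists_bound Φ
  integrableOn_pvKer Φ.differentiable h0 h1 p

theorem hasPV_integral (Φ : 𝓢(ℝ, 𝕜)) (p : ℝ) : HasPV Φ p (∫ t in Set.Ioi 0, pvKer Φ p t) := by
  have h := (aecover_Ioi_of_Ioi (μ := volume) (l := 𝓝[>] (0 : ℝ)) (a := id) (A := 0)
    nhdsWithin_le_nhds).integral_tendsto_of_countably_generated (integrableOn_pvKer_schwartz Φ p)
  refine h.congr' ?_
  filter_upwards [self_mem_nhdsWithin] with δ (hδ : 0 < δ)
  rw [pvTrunc_eq Φ.integrable p hδ, id, Measure.restrict_restrict measurableSet_Ioi,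
    Set.inter_eq_left.2 (Set.Ioi_subset_Ioi hδ.le)]

theorem pv_eq_integral (Φ : 𝓢(ℝ, 𝕜)) (p : ℝ) : pv Φ p = ∫ t in Set.Ioi 0, pvKer Φ p t :=
  (hasPV_integral Φ p).limUnder_eq

theorem hasPV_pv (Φ : 𝓢(ℝ, 𝕜)) (p : ℝ) : HasPV Φ p (pv Φ p) :=
  pv_eq_integral Φ p ▸ hasPV_integral Φ p

/-- The principal value as a linear functional on Schwartz functions. -/
def pvL (p : ℝ) : 𝓢(ℝ, 𝕜) →ₗ[𝕜] 𝕜 where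
  toFun Φ := pv Φ p
  map_add' Φ Ψ := by
    simp only [pv_eq_integral]
    rw [← integral_add (integrableOn_pvKer_schwartz Φ p) (integrableOn_pvKer_schwartz Ψ p)]
    congr 1 with t
    simp only [pvKer, _root_.add_apply]
    ring
  map_smul' c Φ := by
    simp only [pv_eq_integral, RingHom.id_apply, smul_eq_mul]
    rw [← integral_const_mul]
    congr 1 with t
    simp only [pvKer, _root_.smul_apply, smul_eq_mul]
    ring

theorem pvL_apply (p : ℝ) (Φ : 𝓢(ℝ, 𝕜)) : pvL p Φ = pv Φ p := rfl

theorem norm_pv_le {Φ : 𝓢(ℝ, 𝕜)} {A : ℝ} (h0 : ∀ x, (1 + x ^ 2) * ‖Φ x‖ ≤ A)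
    (h1 : ∀ x, ‖deriv Φ x‖ ≤ A) (p : ℝ) : ‖pv Φ p‖ ≤ 4 * A * (1 + p ^ 2) * Real.pi :=
  pv_eq_integral Φ p ▸ norm_integral_pvKer_le Φ.differentiable h0 h1 p

/-- The derivative as an operator on Schwartz functions. -/
abbrev dS (Φ : 𝓢(ℝ, 𝕜)) : 𝓢(ℝ, 𝕜) := derivCLM 𝕜 𝕜 Φ

/-- The kernel commutes with translation in `p`, so differentiation passes to `Φ` under the
integral. The weight `(|p| + 1) ^ 2` dominates uniformly over the unit ball around `p`. -/
theorem hasDerivAt_pv (Φ : 𝓢(ℝ, 𝕜)) (p : ℝ) : HasDerivAt (pv Φ) (pv (dS Φ) p) p := by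
  obtain ⟨A, h0, h1⟩ := exists_bound (dS Φ)
  have hA : 0 ≤ A := (norm_nonneg _).trans (h1 0)
  have hb := (integrable_inv_one_add_sq.const_mul (4 * A * (1 + (|p| + 1) ^ 2))).integrableOn
    (s := Set.Ioi 0)
  have key := (hasDerivAt_integral_of_dominated_loc_of_deriv_le (μ := volume.restrict (Set.Ioi 0))
    (F := pvKer Φ) (F' := pvKer (dS Φ)) (x₀ := p) (Metric.ball_mem_nhds p one_pos)
    (Eventually.of_forall fun x => (measurable_pvKer Φ.differentiable x).aestronglyMeasurable)
    (integrableOn_pvKer_schwartz Φ p)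
    (measurable_pvKer (dS Φ).differentiable p).aestronglyMeasurable
    (?_) hb (ae_of_all _ fun t x _ => ?_)).2
  · rw [pv_eq_integral]
    exact key.congr_of_eventuallyEq (Eventually.of_forall (pv_eq_integral Φ))
  · refine (ae_restrict_mem measurableSet_Ioi).mono fun t ht x hx => ?_
    refine (norm_pvKer_le (dS Φ).differentiable h0 h1 x ht).trans ?_
    have : |x| ≤ |p| + 1 := by
      rw [Metric.mem_ball, Real.dist_eq] at hx
      linarith [abs_sub_abs_le_abs_sub x p]
    rw [← sq_abs x]
    gcongr
  · have hd (y : ℝ) : HasDerivAt Φ (dS Φ y) y := (Φ.differentiableAt).hasDerivAt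
    exact (((hd _).comp_sub_const x t).sub ((hd _).comp_add_const x t)).div_const _

theorem deriv_pv (Φ : 𝓢(ℝ, 𝕜)) : deriv (pv Φ) = pv (dS Φ) :=
  funext fun p => (hasDerivAt_pv Φ p).deriv

theorem iteratedDeriv_pv (Φ : 𝓢(ℝ, 𝕜)) (n : ℕ) : iteratedDeriv n (pv Φ) = pv (dS^[n] Φ) := by
  induction n generalizing Φ with
  | zero => simp
  | succ n ih => rw [iteratedDeriv_succ', deriv_pv, ih, Function.iterate_succ_apply]

theorem hasTemperateGrowth_pv (Φ : 𝓢(ℝ, 𝕜)) : Function.HasTemperateGrowth (pv Φ) := by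
  refine ⟨contDiff_of_differentiable_iteratedDeriv fun m _ => ?_, fun n => ?_⟩
  · rw [iteratedDeriv_pv]
    exact fun p => (hasDerivAt_pv _ p).differentiableAt
  · obtain ⟨A, h0, h1⟩ := exists_bound (dS^[n] Φ)
    have hA : 0 ≤ A := (norm_nonneg _).trans (h1 0)
    refine ⟨2, 4 * A * Real.pi, fun p => ?_⟩
    rw [norm_iteratedFDeriv_eq_norm_iteratedDeriv, iteratedDeriv_pv, Real.norm_eq_abs]
    refine (norm_pv_le h0 h1 p).trans ?_
    rw [mul_right_comm]
    gcongr
    nlinarith [abs_nonneg p, sq_abs p]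

theorem hasDerivAt_lam (f : 𝓢(ℝ, 𝕜)) (p : ℝ) : HasDerivAt (lam f) (1 + pv (dS f) p) p :=
  (RCLike.ofRealCLM (K := 𝕜)).hasDerivAt.congr_deriv (by simp) |>.add (hasDerivAt_pv f p)

/-! ### Multipliers of temperate growth and the product in terms of coefficients -/

theorem hasTemperateGrowth_deriv {h : ℝ → 𝕜} (hh : h.HasTemperateGrowth) :
    (deriv h).HasTemperateGrowth := by
  refine ⟨(contDiff_infty_iff_deriv.1 hh.1).2, fun n => ?_⟩
  obtain ⟨k, C, hC⟩ := hh.2 (n + 1)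
  refine ⟨k, C, fun x => ?_⟩
  rw [norm_iteratedFDeriv_eq_norm_iteratedDeriv, ← iteratedDeriv_succ',
    ← norm_iteratedFDeriv_eq_norm_iteratedDeriv]
  exact hC x

theorem differentiable_of_temperate {h : ℝ → 𝕜} (hh : h.HasTemperateGrowth) :
    Differentiable ℝ h :=
  (contDiff_infty_iff_deriv.1 hh.1).1

theorem exists_growth {h : ℝ → 𝕜} (hh : h.HasTemperateGrowth) :
    ∃ (N : ℕ) (C : ℝ), 0 ≤ C ∧ ∀ x, ‖h x‖ ≤ C * (1 + |x|) ^ N ∧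
      ‖deriv h x‖ ≤ C * (1 + |x|) ^ N := by
  obtain ⟨N, C, hC, H⟩ := hh.norm_iteratedFDeriv_le_uniform 1
  refine ⟨N, C, hC, fun x => ⟨?_, ?_⟩⟩
  · simpa using H 0 (by simp) x
  · simpa [norm_iteratedFDeriv_eq_norm_iteratedDeriv] using H 1 le_rfl x

/-- Multiplication of a Schwartz function by a function of temperate growth. -/
abbrev mS (h : ℝ → 𝕜) (Φ : 𝓢(ℝ, 𝕜)) : 𝓢(ℝ, 𝕜) := smulLeftCLM 𝕜 h Φ

theorem mS_apply {h : ℝ → 𝕜} (hh : h.HasTemperateGrowth) (Φ : 𝓢(ℝ, 𝕜)) (p : ℝ) :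
    mS h Φ p = h p * Φ p := by
  rw [mS, smulLeftCLM_apply_apply hh, smul_eq_mul]

theorem dS_apply (Φ : 𝓢(ℝ, 𝕜)) (p : ℝ) : dS Φ p = deriv Φ p := derivCLM_apply 𝕜 Φ p

theorem dS_mS {h : ℝ → 𝕜} (hh : h.HasTemperateGrowth) (Φ : 𝓢(ℝ, 𝕜)) :
    dS (mS h Φ) = mS (deriv h) Φ + mS h (dS Φ) := by
  ext p
  have hfun : (mS h Φ : ℝ → 𝕜) = h * Φ := funext (mS_apply hh Φ)
  rw [dS_apply, hfun, deriv_mul (differentiable_of_temperate hh p) Φ.differentiableAt,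
    _root_.add_apply, mS_apply (hasTemperateGrowth_deriv hh), mS_apply hh, dS_apply]

/-- The coefficient of `(h f') ∘ (k f')` with respect to `f'`. -/
def coefProd (f : 𝓢(ℝ, 𝕜)) (h k : ℝ → 𝕜) (p : ℝ) : 𝕜 :=
  k p * pv (mS h (dS f)) p + h p * pv (mS k (dS f)) p - pv (mS (h * k) (dS f)) p
    - h p * k p * (1 + pv (dS f) p)

theorem mul_div_deriv_eq {f : 𝓢(ℝ, 𝕜)} {h k X Y : ℝ → 𝕜} (hX : ∀ q, X q = h q * deriv f q)
    (hY : ∀ q, Y q = k q * deriv f q) (q : ℝ) :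
    X q * Y q / deriv f q = h q * k q * deriv f q := by
  rw [hX, hY]
  rcases eq_or_ne (deriv f q) 0 with h0 | h0
  · simp [h0]
  · field_simp

theorem mul_div_deriv_eq_mS {f : 𝓢(ℝ, 𝕜)} {h k X Y : ℝ → 𝕜} (hh : h.HasTemperateGrowth)
    (hk : k.HasTemperateGrowth) (hX : ∀ q, X q = h q * deriv f q)
    (hY : ∀ q, Y q = k q * deriv f q) :
    (fun q => X q * Y q / deriv f q) = mS (h * k) (dS f) := by
  ext q
  rw [mul_div_deriv_eq hX hY, mS_apply (hh.mul hk), dS_apply, Pi.mul_apply]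

theorem eq_mS {f : 𝓢(ℝ, 𝕜)} {h X : ℝ → 𝕜} (hh : h.HasTemperateGrowth)
    (hX : ∀ q, X q = h q * deriv f q) : X = mS h (dS f) := by
  ext q
  rw [hX, mS_apply hh, dS_apply]

theorem cPair_eq {f : 𝓢(ℝ, 𝕜)} {h k X Y : ℝ → 𝕜} (hh : h.HasTemperateGrowth)
    (hk : k.HasTemperateGrowth) (hX : ∀ q, X q = h q * deriv f q)
    (hY : ∀ q, Y q = k q * deriv f q) (p : ℝ) :
    cPair f p X Y = coefProd f h k p * deriv f p := by
  simp only [cPair, delta, mul_div_deriv_eq hX hY, (hasDerivAt_lam f p).deriv]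
  -- The quotient is folded back so that, as a function under `pv`, it can be replaced by a Schwartz
  -- function.
  simp only [← mul_div_deriv_eq hX hY, mul_div_deriv_eq_mS hh hk hX hY]
  rw [mul_div_deriv_eq hX hY, coefProd, ← eq_mS hh hX, ← eq_mS hk hY, hX p, hY p]
  ring

theorem hasTemperateGrowth_coefProd (f : 𝓢(ℝ, 𝕜)) {h k : ℝ → 𝕜} (hh : h.HasTemperateGrowth)
    (hk : k.HasTemperateGrowth) : (coefProd f h k).HasTemperateGrowth := by
  have h1 := hasTemperateGrowth_pv (mS h (dS f))
  have h2 := hasTemperateGrowth_pv (mS k (dS f))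
  have h3 := hasTemperateGrowth_pv (mS (h * k) (dS f))
  have h4 := hasTemperateGrowth_pv (dS f)
  exact (((hk.mul h1).add (hh.mul h2)).sub h3).sub
    ((hh.mul hk).mul ((Function.HasTemperateGrowth.const 1).add h4))

theorem coefProd_comm (f : 𝓢(ℝ, 𝕜)) (h k : ℝ → 𝕜) : coefProd f h k = coefProd f k h := by
  ext p
  rw [coefProd, coefProd, mul_comm h k]
  ring

theorem coefProd_add_left (f : 𝓢(ℝ, 𝕜)) {h h' k : ℝ → 𝕜} (hh : h.HasTemperateGrowth)
    (hh' : h'.HasTemperateGrowth) (hk : k.HasTemperateGrowth) (p : ℝ) :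
    coefProd f (h + h') k p = coefProd f h k p + coefProd f h' k p := by
  have e1 : mS (h + h') (dS f) = mS h (dS f) + mS h' (dS f) := by
    rw [mS, smulLeftCLM_add hh hh', _root_.add_apply]
  have e2 : mS ((h + h') * k) (dS f) = mS (h * k) (dS f) + mS (h' * k) (dS f) := by
    rw [mS, add_mul, smulLeftCLM_add (hh.mul hk) (hh'.mul hk), _root_.add_apply]
  simp only [coefProd, ← pvL_apply, e1, e2, map_add, Pi.add_apply]
  ring

theorem coefProd_smul_left (f : 𝓢(ℝ, 𝕜)) {h k : ℝ → 𝕜} (hh : h.HasTemperateGrowth)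
    (hk : k.HasTemperateGrowth) (c : 𝕜) (p : ℝ) :
    coefProd f (c • h) k p = c * coefProd f h k p := by
  have e1 : mS (c • h) (dS f) = c • mS h (dS f) := by
    rw [mS, smulLeftCLM_smul hh, _root_.smul_apply]
  have e2 : mS (c • h * k) (dS f) = c • mS (h * k) (dS f) := by
    rw [mS, smul_mul_assoc, smulLeftCLM_smul (hh.mul hk), _root_.smul_apply]
  simp only [coefProd, ← pvL_apply, e1, e2, map_smul, Pi.smul_apply, smul_eq_mul]
  ring

/-! ### The bilinear product on `V f` -/

theorem exists_mem_V_cPair (f : 𝓢(ℝ, 𝕜)) (X Y : V f) :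
    ∃ W : V f, ∀ p, (W : 𝓢(ℝ, 𝕜)) p = cPair f p (X : 𝓢(ℝ, 𝕜)) (Y : 𝓢(ℝ, 𝕜)) := by
  obtain ⟨h, hh, hX⟩ := X.2
  obtain ⟨k, hk, hY⟩ := Y.2
  have hc := hasTemperateGrowth_coefProd f hh hk
  have hW (p : ℝ) : mS (coefProd f h k) (dS f) p = coefProd f h k p * deriv f p := by
    rw [mS_apply hc, dS_apply]
  exact ⟨⟨mS (coefProd f h k) (dS f), coefProd f h k, hc, hW⟩, fun p => by
    rw [cPair_eq hh hk hX hY, hW]⟩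

/-- The product on `V f` as a bare function. -/
def prodV (f : 𝓢(ℝ, 𝕜)) (X Y : V f) : V f := (exists_mem_V_cPair f X Y).choose

theorem prodV_eq_cPair (f : 𝓢(ℝ, 𝕜)) (X Y : V f) (p : ℝ) :
    (prodV f X Y : 𝓢(ℝ, 𝕜)) p = cPair f p (X : 𝓢(ℝ, 𝕜)) (Y : 𝓢(ℝ, 𝕜)) :=
  (exists_mem_V_cPair f X Y).choose_spec p

theorem prodV_apply {f : 𝓢(ℝ, 𝕜)} {X Y : V f} {h k : ℝ → 𝕜} (hh : h.HasTemperateGrowth)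
    (hk : k.HasTemperateGrowth) (hX : ∀ q, (X : 𝓢(ℝ, 𝕜)) q = h q * deriv f q)
    (hY : ∀ q, (Y : 𝓢(ℝ, 𝕜)) q = k q * deriv f q) (p : ℝ) :
    (prodV f X Y : 𝓢(ℝ, 𝕜)) p = coefProd f h k p * deriv f p := by
  rw [prodV_eq_cPair, cPair_eq hh hk hX hY]

theorem prodV_comm (f : 𝓢(ℝ, 𝕜)) (X Y : V f) : prodV f X Y = prodV f Y X := by
  obtain ⟨h, hh, hX⟩ := X.2
  obtain ⟨k, hk, hY⟩ := Y.2
  ext p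
  rw [prodV_apply hh hk hX hY, prodV_apply hk hh hY hX, coefProd_comm]

theorem prodV_add_left (f : 𝓢(ℝ, 𝕜)) (X X' Y : V f) :
    prodV f (X + X') Y = prodV f X Y + prodV f X' Y := by
  obtain ⟨h, hh, hX⟩ := X.2
  obtain ⟨h', hh', hX'⟩ := X'.2
  obtain ⟨k, hk, hY⟩ := Y.2
  ext p
  have hXX (q : ℝ) : ((X + X' : V f) : 𝓢(ℝ, 𝕜)) q = (h + h') q * deriv f q := by
    rw [Submodule.coe_add, _root_.add_apply, hX, hX', Pi.add_apply, add_mul]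
  rw [prodV_apply (hh.add hh') hk hXX hY, Submodule.coe_add, _root_.add_apply,
    prodV_apply hh hk hX hY, prodV_apply hh' hk hX' hY, coefProd_add_left f hh hh' hk, add_mul]

theorem prodV_smul_left (f : 𝓢(ℝ, 𝕜)) (c : 𝕜) (X Y : V f) :
    prodV f (c • X) Y = c • prodV f X Y := by
  obtain ⟨h, hh, hX⟩ := X.2
  obtain ⟨k, hk, hY⟩ := Y.2
  ext p
  have hcX (q : ℝ) : ((c • X : V f) : 𝓢(ℝ, 𝕜)) q = (c • h) q * deriv f q := by
    rw [Submodule.coe_smul, _root_.smul_apply, hX, Pi.smul_apply, smul_eq_mul, smul_eq_mul,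
      mul_assoc]
  have hch : (c • h).HasTemperateGrowth := (Function.HasTemperateGrowth.const c).mul hh
  rw [prodV_apply hch hk hcX hY, Submodule.coe_smul, _root_.smul_apply,
    prodV_apply hh hk hX hY, coefProd_smul_left f hh hk, smul_eq_mul, mul_assoc]

/-- The product on `V f` as a bilinear map. -/
def mulV (f : 𝓢(ℝ, 𝕜)) : V f →ₗ[𝕜] V f →ₗ[𝕜] V f :=
  LinearMap.mk₂ 𝕜 (prodV f) (prodV_add_left f) (prodV_smul_left f)
    (fun X Y Y' => by
      rw [prodV_comm, prodV_add_left, prodV_comm f Y, prodV_comm f Y'])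
    (fun c X Y => by rw [prodV_comm, prodV_smul_left, prodV_comm f Y])

/-! ### The product as a nonsingular integral -/

/-- The first divided difference. -/
def dd (h : ℝ → 𝕜) (p q : ℝ) : 𝕜 := (h p - h q) / ((p - q : ℝ) : 𝕜)

/-- Measurable kernels of polynomial growth. -/
def PolyKer (G : ℝ → ℝ → 𝕜) : Prop :=
  Measurable (Function.uncurry G) ∧
    ∃ (N : ℕ) (C : ℝ), 0 ≤ C ∧ ∀ q s, ‖G q s‖ ≤ C * ((1 + |q|) * (1 + |s|)) ^ N

theorem PolyKer.sub {G G' : ℝ → ℝ → 𝕜} (hG : PolyKer G) (hG' : PolyKer G') :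
    PolyKer (fun q s => G q s - G' q s) := by
  obtain ⟨hm, N, C, hC, hb⟩ := hG
  obtain ⟨hm', N', C', hC', hb'⟩ := hG'
  refine ⟨hm.sub hm', max N N', C + C', by positivity, fun q s => ?_⟩
  have h1 : 1 ≤ (1 + |q|) * (1 + |s|) := by
    nlinarith [abs_nonneg q, abs_nonneg s, mul_nonneg (abs_nonneg q) (abs_nonneg s)]
  calc ‖G q s - G' q s‖ ≤ ‖G q s‖ + ‖G' q s‖ := norm_sub_le _ _
    _ ≤ C * ((1 + |q|) * (1 + |s|)) ^ N + C' * ((1 + |q|) * (1 + |s|)) ^ N' :=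
        add_le_add (hb q s) (hb' q s)
    _ ≤ C * ((1 + |q|) * (1 + |s|)) ^ max N N' + C' * ((1 + |q|) * (1 + |s|)) ^ max N N' := by
        gcongr
        · exact le_max_left _ _
        · exact le_max_right _ _
    _ = _ := by ring

theorem PolyKer.mul {G G' : ℝ → ℝ → 𝕜} (hG : PolyKer G) (hG' : PolyKer G') :
    PolyKer (fun q s => G q s * G' q s) := by
  obtain ⟨hm, N, C, hC, hb⟩ := hG
  obtain ⟨hm', N', C', hC', hb'⟩ := hG'
  refine ⟨hm.mul hm', N + N', C * C', by positivity, fun q s => ?_⟩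
  calc ‖G q s * G' q s‖ = ‖G q s‖ * ‖G' q s‖ := norm_mul _ _
    _ ≤ (C * ((1 + |q|) * (1 + |s|)) ^ N) * (C' * ((1 + |q|) * (1 + |s|)) ^ N') := by
        gcongr
        · exact hb q s
        · exact hb' q s
    _ = _ := by ring

theorem PolyKer.const_left {G : ℝ → ℝ → 𝕜} (hG : PolyKer G) (p : ℝ) :
    PolyKer (fun _ s => G p s) := by
  obtain ⟨hm, N, C, hC, hb⟩ := hG
  refine ⟨hm.comp (measurable_const.prodMk measurable_snd), N, C * (1 + |p|) ^ N, by positivity,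
    fun q s => (hb p s).trans ?_⟩
  rw [mul_assoc, ← mul_pow]
  gcongr
  nlinarith [abs_nonneg q, abs_nonneg s, mul_nonneg (abs_nonneg q) (abs_nonneg s)]

theorem PolyKer.swap {G : ℝ → ℝ → 𝕜} (hG : PolyKer G) : PolyKer (fun q s => G s q) := by
  obtain ⟨hm, N, C, hC, hb⟩ := hG
  refine ⟨hm.comp measurable_swap, N, C, hC, fun q s => (hb s q).trans_eq ?_⟩
  rw [mul_comm (1 + |s|)]

theorem integrable_pow_mul_norm (Φ : 𝓢(ℝ, 𝕜)) (N : ℕ) :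
    Integrable (fun q => (1 + |q|) ^ N * ‖Φ q‖) := by
  refine Integrable.mono' (((Φ.integrable_pow_mul volume 0).add
    (Φ.integrable_pow_mul volume N)).const_mul (2 ^ N)) (by fun_prop) (ae_of_all _ fun q => ?_)
  simp only [Pi.add_apply, pow_zero, ← add_mul, Real.norm_eq_abs, abs_mul, abs_norm, ← mul_assoc]
  gcongr
  rw [abs_of_nonneg (by positivity)]
  rcases le_total |q| 1 with h | h
  · calc (1 + |q|) ^ N ≤ 2 ^ N := by gcongr; linarith
      _ ≤ _ := le_mul_of_one_le_right (by positivity) (by simp)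
  · calc (1 + |q|) ^ N ≤ (2 * |q|) ^ N := by gcongr; linarith
      _ ≤ _ := by rw [mul_pow]; gcongr; simp

/-- Schwartz decay in both variables beats polynomial growth of the kernel; this licenses every use
of Fubini below. -/
theorem PolyKer.integrable_prod {G : ℝ → ℝ → 𝕜} (hG : PolyKer G) (Φ Ψ : 𝓢(ℝ, 𝕜)) :
    Integrable (Function.uncurry fun q s => G q s * (Φ q * Ψ s)) (volume.prod volume) := by
  obtain ⟨hm, N, C, hC, hb⟩ := hG
  refine Integrable.mono' (((integrable_pow_mul_norm Φ N).mul_prod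
    (integrable_pow_mul_norm Ψ N)).const_mul C) ?_ (ae_of_all _ fun z => ?_)
  · exact (hm.mul (by have := Φ.continuous.measurable; have := Ψ.continuous.measurable
                      fun_prop)).aestronglyMeasurable
  · obtain ⟨q, s⟩ := z
    simp only [Function.uncurry_apply_pair, norm_mul]
    calc ‖G q s‖ * (‖Φ q‖ * ‖Ψ s‖)
        ≤ C * ((1 + |q|) * (1 + |s|)) ^ N * (‖Φ q‖ * ‖Ψ s‖) := by gcongr; exact hb q s
      _ = _ := by rw [mul_pow]; ring

theorem PolyKer.integrable_integral {G : ℝ → ℝ → 𝕜} (hG : PolyKer G) (Φ Ψ : 𝓢(ℝ, 𝕜)) :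
    Integrable (fun q => ∫ s, G q s * (Φ q * Ψ s)) :=
  (hG.integrable_prod Φ Ψ).integral_prod_left

theorem PolyKer.integrable {G : ℝ → ℝ → 𝕜} (hG : PolyKer G) (p : ℝ) (Φ : 𝓢(ℝ, 𝕜)) :
    Integrable (fun q => G p q * Φ q) := by
  obtain ⟨hm, N, C, hC, hb⟩ := hG
  have hm' : Measurable (G p) := hm.comp (measurable_const.prodMk measurable_id)
  refine Integrable.mono' ((integrable_pow_mul_norm Φ N).const_mul (C * (1 + |p|) ^ N))
    (hm'.aestronglyMeasurable.mul Φ.continuous.aestronglyMeasurable) (ae_of_all _ fun q => ?_)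
  rw [norm_mul]
  calc ‖G p q‖ * ‖Φ q‖ ≤ C * ((1 + |p|) * (1 + |q|)) ^ N * ‖Φ q‖ := by gcongr; exact hb p q
    _ = _ := by rw [mul_pow]; ring

theorem polyKer_sub {h : ℝ → 𝕜} (hh : h.HasTemperateGrowth) : PolyKer (fun p q => h p - h q) := by
  obtain ⟨N, C, hC, H⟩ := exists_growth hh
  have hm := (differentiable_of_temperate hh).continuous.measurable
  have key : PolyKer (fun _ q => h q) := by
    refine ⟨hm.comp measurable_snd, N, C, hC, fun p q => (H q).1.trans ?_⟩
    gcongr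
    nlinarith [abs_nonneg q, abs_nonneg p, mul_nonneg (abs_nonneg q) (abs_nonneg p)]
  exact key.swap.sub key

theorem polyKer_dd {h : ℝ → 𝕜} (hh : h.HasTemperateGrowth) : PolyKer (dd h) := by
  obtain ⟨N, C, hC, H⟩ := exists_growth hh
  have hm := (differentiable_of_temperate hh).continuous.measurable
  refine ⟨?_, N, C, hC, fun p q => ?_⟩
  · unfold dd Function.uncurry
    fun_prop
  · have hb : 0 ≤ C * ((1 + |p|) * (1 + |q|)) ^ N := by positivity
    rw [dd, norm_div, RCLike.norm_ofReal]
    refine div_le_of_le_mul₀ (abs_nonneg _) hb ?_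
    -- The mean value theorem on the symmetric interval containing both `p` and `q`, where `1 + |x|`
    -- is at most `(1 + |p|) * (1 + |q|)`.
    refine Convex.norm_image_sub_le_of_norm_deriv_le (s := Set.Icc (-max |p| |q|) (max |p| |q|))
      (fun x _ => differentiable_of_temperate hh x) (fun x hx => (H x).2.trans ?_)
      (convex_Icc _ _) (abs_le.1 (le_max_right _ _)) (abs_le.1 (le_max_left _ _))
    have hx' : |x| ≤ max |p| |q| := abs_le.2 hx
    gcongr
    rcases le_max_iff.1 hx' with h | h <;>
      nlinarith [abs_nonneg q, abs_nonneg p, mul_nonneg (abs_nonneg q) (abs_nonneg p)]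

/-- The kernel `(h(p)-h(q))(k(p)-k(q))/(p-q)`. -/
def ddMul (h k : ℝ → 𝕜) (p q : ℝ) : 𝕜 := (h p - h q) * dd k p q

theorem polyKer_ddMul {h k : ℝ → 𝕜} (hh : h.HasTemperateGrowth) (hk : k.HasTemperateGrowth) :
    PolyKer (ddMul h k) :=
  (polyKer_sub hh).mul (polyKer_dd hk)

/-- All principal values are collected into that of one Schwartz function `Ψ`, whose quotient by `p
- q` is an integrable kernel. Its truncated integrals therefore converge to the ordinary integral,
and limits are unique. -/
theorem coefProd_eq_integral (f : 𝓢(ℝ, 𝕜)) {h k : ℝ → 𝕜} (hh : h.HasTemperateGrowth)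
    (hk : k.HasTemperateGrowth) (p : ℝ) :
    coefProd f h k p = -(h p * k p) - ∫ q, ddMul h k p q * dS f q := by
  set Ψ : 𝓢(ℝ, 𝕜) := k p • mS h (dS f) + h p • mS k (dS f) - mS (h * k) (dS f)
    - (h p * k p) • dS f with hΨ
  have hΨq (q : ℝ) : Ψ q / ((p - q : ℝ) : 𝕜) = -(ddMul h k p q * dS f q) := by
    simp only [hΨ, _root_.sub_apply, _root_.add_apply, _root_.smul_apply, mS_apply hh,
      mS_apply hk, mS_apply (hh.mul hk), smul_eq_mul, Pi.mul_apply, ddMul, dd]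
    ring
  have hcover : AECover volume (𝓝[>] (0 : ℝ)) (fun δ => {q : ℝ | δ < |p - q|}) := by
    refine ⟨?_, fun δ => measurableSet_lt (by fun_prop) (by fun_prop)⟩
    filter_upwards [compl_mem_ae_iff.2 (measure_singleton p)] with q hq
    have : 0 < |p - q| := abs_pos.2 (sub_ne_zero.2 (Ne.symm hq))
    exact nhdsWithin_le_nhds (Iio_mem_nhds this)
  have hlim := hcover.integral_tendsto_of_countably_generated
    ((polyKer_ddMul hh hk).integrable p (dS f)).neg
  have hlim' : HasPV Ψ p (∫ q, -(ddMul h k p q * dS f q)) := by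
    refine hlim.congr fun δ => ?_
    simp only [pvTrunc, hΨq, Pi.neg_apply]
  have huniq := tendsto_nhds_unique (hasPV_pv Ψ p) hlim'
  rw [integral_neg, ← pvL_apply, hΨ] at huniq
  simp only [map_sub, map_add, map_smul, smul_eq_mul] at huniq
  simp only [pvL_apply] at huniq
  rw [coefProd]
  linear_combination huniq

/-! ### Associativity -/

/-- The kernel of the quadratic part of `((h f') ∘ (k f')) ∘ (l f')`. -/
def tripleKer (h k l : ℝ → 𝕜) (p q s : ℝ) : 𝕜 := (ddMul h k p s - ddMul h k q s) * dd l p q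

theorem polyKer_tripleKer {h k l : ℝ → 𝕜} (hh : h.HasTemperateGrowth)
    (hk : k.HasTemperateGrowth) (hl : l.HasTemperateGrowth) (p : ℝ) :
    PolyKer (tripleKer h k l p) :=
  (((polyKer_ddMul hh hk).const_left p).sub (polyKer_ddMul hh hk)).mul
    ((polyKer_dd hl).const_left p).swap

/-- Let a, b be the increments of `h` from `p` to `q` and to `s`, and A, B those of `l`. After
clearing denominators only aA, aB + bA and (b-a)(B-A) survive, all invariant under exchanging `h`
and `l`. On the diagonals `dd` takes the value 0, so these cases are checked separately. -/
theorem tripleKer_add_swap (h k l : ℝ → 𝕜) (p q s : ℝ) :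
    tripleKer h k l p q s + tripleKer h k l p s q =
      tripleKer l k h p q s + tripleKer l k h p s q := by
  simp only [tripleKer, ddMul, dd]
  rcases eq_or_ne p q with rfl | hpq
  · simp; ring
  rcases eq_or_ne p s with rfl | hps
  · simp; ring
  rcases eq_or_ne q s with rfl | hqs
  · simp; ring
  have h1 : (p : 𝕜) - q ≠ 0 := sub_ne_zero.2 (by exact_mod_cast hpq)
  have h2 : (p : 𝕜) - s ≠ 0 := sub_ne_zero.2 (by exact_mod_cast hps)
  have h3 : (q : 𝕜) - s ≠ 0 := sub_ne_zero.2 (by exact_mod_cast hqs)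
  have h4 : (s : 𝕜) - q ≠ 0 := sub_ne_zero.2 (by exact_mod_cast hqs.symm)
  push_cast
  have h5 : (s : 𝕜) - q = -(q - s) := by ring
  rw [h5]
  field_simp
  ring

/-- By Fubini, twice the integral of a kernel against a symmetric weight is the integral of its
symmetrization. -/
theorem integral_integral_of_add_swap_eq {F G : ℝ → ℝ → 𝕜} (hF : PolyKer F) (hG : PolyKer G)
    (h : ∀ q s, F q s + F s q = G q s + G s q) (Φ : 𝓢(ℝ, 𝕜)) :
    ∫ q, ∫ s, F q s * (Φ q * Φ s) = ∫ q, ∫ s, G q s * (Φ q * Φ s) := by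
  have key {H : ℝ → ℝ → 𝕜} (hH : PolyKer H) :
      2 * ∫ q, ∫ s, H q s * (Φ q * Φ s) = ∫ q, ∫ s, (H q s + H s q) * (Φ q * Φ s) := by
    have i1 := hH.integrable_prod Φ Φ
    have i2 := hH.swap.integrable_prod Φ Φ
    have hs : ∫ q, ∫ s, H q s * (Φ q * Φ s) = ∫ q, ∫ s, H s q * (Φ q * Φ s) := by
      rw [integral_integral_swap i1]
      congr 1 with q
      congr 1 with s
      ring
    rw [two_mul]
    nth_rewrite 2 [hs]
    simp only [add_mul]
    exact (integral_integral_add i1 i2).symm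
  have h2 : (2 : 𝕜) ≠ 0 := two_ne_zero
  apply mul_left_cancel₀ h2
  simp only [key hF, key hG, h]

/-- The nonsingular formula is inserted into itself and sorted by the number of integrations against
f'. -/
theorem coefProd_coefProd_eq (f : 𝓢(ℝ, 𝕜)) {h k l : ℝ → 𝕜} (hh : h.HasTemperateGrowth)
    (hk : k.HasTemperateGrowth) (hl : l.HasTemperateGrowth) (p : ℝ) :
    coefProd f (coefProd f h k) l p = h p * k p * l p
      + (∫ q, (l p * ddMul h k p q + ddMul (h * k) l p q) * dS f q)
      + ∫ q, ∫ s, tripleKer h k l p q s * (dS f q * dS f s) := by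
  have hb := hasTemperateGrowth_coefProd f hh hk
  have hI (r : ℝ) := (polyKer_ddMul hh hk).integrable r (dS f)
  have i1 := ((polyKer_ddMul hh hk).integrable p (dS f)).const_mul (l p)
  have i2 := (polyKer_ddMul (hh.mul hk) hl).integrable p (dS f)
  have i3 := (polyKer_tripleKer hh hk hl p).integrable_integral (dS f) (dS f)
  have hpt (q : ℝ) : ddMul (coefProd f h k) l p q * dS f q =
      -(ddMul (h * k) l p q * dS f q)
        - ∫ s, tripleKer h k l p q s * (dS f q * dS f s) := by
    have e : ∫ s, tripleKer h k l p q s * (dS f q * dS f s) =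
        (dd l p q * dS f q) * ((∫ s, ddMul h k p s * dS f s) - ∫ s, ddMul h k q s * dS f s) := by
      rw [← integral_sub (hI p) (hI q), ← integral_const_mul]
      congr 1 with s
      rw [tripleKer]
      ring
    rw [e, ddMul, coefProd_eq_integral f hh hk p, coefProd_eq_integral f hh hk q, ddMul]
    simp only [Pi.mul_apply]
    ring
  rw [coefProd_eq_integral f hb hl]
  simp only [hpt]
  rw [integral_sub (by exact i2.neg) i3, integral_neg, coefProd_eq_integral f hh hk p]
  simp only [add_mul, mul_assoc] at i1 ⊢
  rw [integral_add i1 i2, integral_const_mul]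
  ring

/-- Exchanging the outer factors is, given commutativity, the same as associativity. The local and
single-integral terms are symmetric pointwise; the double integral is so only after symmetrizing its
kernel. -/
theorem coefProd_coefProd_symm (f : 𝓢(ℝ, 𝕜)) {h k l : ℝ → 𝕜} (hh : h.HasTemperateGrowth)
    (hk : k.HasTemperateGrowth) (hl : l.HasTemperateGrowth) (p : ℝ) :
    coefProd f (coefProd f h k) l p = coefProd f (coefProd f l k) h p := by
  rw [coefProd_coefProd_eq f hh hk hl, coefProd_coefProd_eq f hl hk hh,
    integral_integral_of_add_swap_eq (polyKer_tripleKer hh hk hl p)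
      (polyKer_tripleKer hl hk hh p) (tripleKer_add_swap h k l p)]
  congr 2
  · ring
  · congr 1 with q
    simp only [ddMul, dd, Pi.mul_apply]
    ring

theorem prodV_prodV_symm (f : 𝓢(ℝ, 𝕜)) (X Y Z : V f) :
    prodV f (prodV f X Y) Z = prodV f (prodV f Z Y) X := by
  obtain ⟨h, hh, hX⟩ := X.2
  obtain ⟨k, hk, hY⟩ := Y.2
  obtain ⟨l, hl, hZ⟩ := Z.2
  ext p
  rw [prodV_apply (hasTemperateGrowth_coefProd f hh hk) hl (prodV_apply hh hk hX hY) hZ,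
    prodV_apply (hasTemperateGrowth_coefProd f hl hk) hh (prodV_apply hl hk hZ hY) hX,
    coefProd_coefProd_symm f hh hk hl]

theorem prodV_assoc (f : 𝓢(ℝ, 𝕜)) (X Y Z : V f) :
    prodV f (prodV f X Y) Z = prodV f X (prodV f Y Z) := by
  rw [prodV_prodV_symm, prodV_comm f _ X, prodV_comm f Z]

theorem prodV_left_comm (f : 𝓢(ℝ, 𝕜)) (X Y Z : V f) :
    prodV f X (prodV f Y Z) = prodV f Y (prodV f X Z) := by
  rw [← prodV_assoc, prodV_comm f X Y, prodV_assoc]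

/-! ### Invariance of the metric -/

theorem integrable_mul_mul_dS (f : 𝓢(ℝ, 𝕜)) {h k : ℝ → 𝕜} (hh : h.HasTemperateGrowth)
    (hk : k.HasTemperateGrowth) : Integrable (fun p => h p * k p * dS f p) :=
  (mS (h * k) (dS f)).integrable.congr
    (ae_of_all _ fun p => by rw [mS_apply (hh.mul hk), Pi.mul_apply])

/-- The kernel of the nonlocal part of the symmetric trilinear form `η(X, Y ∘ Z)`. -/
def metricKer (h k l : ℝ → 𝕜) (p q : ℝ) : 𝕜 := h p * ddMul k l p q

theorem polyKer_metricKer {h k l : ℝ → 𝕜} (hh : h.HasTemperateGrowth)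
    (hk : k.HasTemperateGrowth) (hl : l.HasTemperateGrowth) : PolyKer (metricKer h k l) := by
  obtain ⟨N, C, hC, H⟩ := exists_growth hh
  have hm := (differentiable_of_temperate hh).continuous.measurable
  have : PolyKer (fun p (_ : ℝ) => h p) := by
    refine ⟨hm.comp measurable_fst, N, C, hC, fun p q => (H p).1.trans ?_⟩
    gcongr
    nlinarith [abs_nonneg q, abs_nonneg p, mul_nonneg (abs_nonneg q) (abs_nonneg p)]
  exact this.mul (polyKer_ddMul hk hl)

/-- Since `dd l` is symmetric, both sides equal (h(p)-h(q))(k(p)-k(q)) `dd l p q`. -/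
theorem metricKer_add_swap (h k l : ℝ → 𝕜) (p q : ℝ) :
    metricKer h k l p q + metricKer h k l q p = metricKer k h l p q + metricKer k h l q p := by
  have e : dd l q p = dd l p q := by
    rw [dd, dd, ← neg_sub (l p), ← neg_sub p q, RCLike.ofReal_neg, neg_div_neg_eq]
  simp only [metricKer, ddMul, e]
  ring

theorem metric_prodV (f : 𝓢(ℝ, 𝕜)) {X Y Z : V f} {h k l : ℝ → 𝕜} (hh : h.HasTemperateGrowth)
    (hk : k.HasTemperateGrowth) (hl : l.HasTemperateGrowth)
    (hX : ∀ q, (X : 𝓢(ℝ, 𝕜)) q = h q * deriv f q) (hY : ∀ q, (Y : 𝓢(ℝ, 𝕜)) q = k q * deriv f q)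
    (hZ : ∀ q, (Z : 𝓢(ℝ, 𝕜)) q = l q * deriv f q) :
    metric f (X : 𝓢(ℝ, 𝕜)) (prodV f Y Z : 𝓢(ℝ, 𝕜)) =
      (∫ p, h p * k p * l p * dS f p)
        + ∫ p, ∫ q, metricKer h k l p q * (dS f p * dS f q) := by
  have i1 := integrable_mul_mul_dS f (hh.mul hk) hl
  have i2 := (polyKer_metricKer hh hk hl).integrable_integral (dS f) (dS f)
  simp only [Pi.mul_apply] at i1
  have hpt (p : ℝ) : (X : 𝓢(ℝ, 𝕜)) p * (prodV f Y Z : 𝓢(ℝ, 𝕜)) p / deriv f p =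
      -(h p * k p * l p * dS f p + ∫ q, metricKer h k l p q * (dS f p * dS f q)) := by
    have e : ∫ q, metricKer h k l p q * (dS f p * dS f q) =
        (h p * dS f p) * ∫ q, ddMul k l p q * dS f q := by
      rw [← integral_const_mul]
      congr 1 with q
      rw [metricKer]
      ring
    rw [mul_div_deriv_eq hX (prodV_apply hk hl hY hZ), coefProd_eq_integral f hk hl, e, dS_apply]
    ring
  simp only [metric, delta, hpt]
  rw [integral_neg, neg_neg, integral_add i1 i2]

theorem metric_prodV_symm (f : 𝓢(ℝ, 𝕜)) (X Y Z : V f) :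
    metric f (X : 𝓢(ℝ, 𝕜)) (prodV f Y Z : 𝓢(ℝ, 𝕜)) =
      metric f (Y : 𝓢(ℝ, 𝕜)) (prodV f X Z : 𝓢(ℝ, 𝕜)) := by
  obtain ⟨h, hh, hX⟩ := X.2
  obtain ⟨k, hk, hY⟩ := Y.2
  obtain ⟨l, hl, hZ⟩ := Z.2
  rw [metric_prodV f hh hk hl hX hY hZ, metric_prodV f hk hh hl hY hX hZ,
    integral_integral_of_add_swap_eq (polyKer_metricKer hh hk hl) (polyKer_metricKer hk hh hl)
      (metricKer_add_swap h k l)]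
  simp only [mul_comm (h _)]

/-! ### Families of polynomially bounded functions -/

/-- The family tends to zero uniformly with respect to a polynomial weight. -/
def WeightSmall (r : ℝ → ℝ → 𝕜) : Prop :=
  ∃ N : ℕ, ∀ a : ℝ, 0 < a → ∀ᶠ ε in 𝓝[≠] (0 : ℝ), ∀ p : ℝ, ‖r ε p‖ ≤ a * (1 + |p|) ^ N

/-- The family is bounded with respect to a polynomial weight. -/
def WeightBdd (r : ℝ → ℝ → 𝕜) : Prop :=
  ∃ (N : ℕ) (C : ℝ), 0 < C ∧ ∀ᶠ ε in 𝓝[≠] (0 : ℝ), ∀ p : ℝ, ‖r ε p‖ ≤ C * (1 + |p|) ^ N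

theorem WeightSmall.bdd {r : ℝ → ℝ → 𝕜} (hr : WeightSmall r) : WeightBdd r :=
  let ⟨N, h⟩ := hr
  ⟨N, 1, one_pos, h 1 one_pos⟩

theorem WeightSmall.add {r s : ℝ → ℝ → 𝕜} (hr : WeightSmall r) (hs : WeightSmall s) :
    WeightSmall (fun ε p => r ε p + s ε p) := by
  obtain ⟨N, hr⟩ := hr
  obtain ⟨M, hs⟩ := hs
  refine ⟨max N M, fun a ha => ?_⟩
  filter_upwards [hr (a / 2) (by positivity), hs (a / 2) (by positivity)] with ε h1 h2 p
  have h0 : 1 ≤ 1 + |p| := by simp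
  calc ‖r ε p + s ε p‖ ≤ a / 2 * (1 + |p|) ^ N + a / 2 * (1 + |p|) ^ M :=
        (norm_add_le _ _).trans (add_le_add (h1 p) (h2 p))
    _ ≤ a / 2 * (1 + |p|) ^ max N M + a / 2 * (1 + |p|) ^ max N M := by
        gcongr
        · exact le_max_left _ _
        · exact le_max_right _ _
    _ = _ := by ring

theorem WeightBdd.add {r s : ℝ → ℝ → 𝕜} (hr : WeightBdd r) (hs : WeightBdd s) :
    WeightBdd (fun ε p => r ε p + s ε p) := by
  obtain ⟨N, C, hC, hr⟩ := hr
  obtain ⟨M, D, hD, hs⟩ := hs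
  refine ⟨max N M, C + D, by positivity, ?_⟩
  filter_upwards [hr, hs] with ε h1 h2 p
  have h0 : 1 ≤ 1 + |p| := by simp
  calc ‖r ε p + s ε p‖ ≤ C * (1 + |p|) ^ N + D * (1 + |p|) ^ M :=
        (norm_add_le _ _).trans (add_le_add (h1 p) (h2 p))
    _ ≤ C * (1 + |p|) ^ max N M + D * (1 + |p|) ^ max N M := by
        gcongr
        · exact le_max_left _ _
        · exact le_max_right _ _
    _ = _ := by ring

theorem WeightBdd.mul {r s : ℝ → ℝ → 𝕜} (hr : WeightBdd r) (hs : WeightBdd s) :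
    WeightBdd (fun ε p => r ε p * s ε p) := by
  obtain ⟨N, C, hC, hr⟩ := hr
  obtain ⟨M, D, hD, hs⟩ := hs
  refine ⟨N + M, C * D, by positivity, ?_⟩
  filter_upwards [hr, hs] with ε h1 h2 p
  calc ‖r ε p * s ε p‖ ≤ (C * (1 + |p|) ^ N) * (D * (1 + |p|) ^ M) := by
        rw [norm_mul]
        exact mul_le_mul (h1 p) (h2 p) (norm_nonneg _) (by positivity)
    _ = _ := by ring

theorem WeightSmall.mul_bdd {r s : ℝ → ℝ → 𝕜} (hr : WeightSmall r) (hs : WeightBdd s) :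
    WeightSmall (fun ε p => r ε p * s ε p) := by
  obtain ⟨N, hr⟩ := hr
  obtain ⟨M, D, hD, hs⟩ := hs
  refine ⟨N + M, fun a ha => ?_⟩
  filter_upwards [hr (a / D) (by positivity), hs] with ε h1 h2 p
  calc ‖r ε p * s ε p‖ ≤ (a / D * (1 + |p|) ^ N) * (D * (1 + |p|) ^ M) := by
        rw [norm_mul]
        exact mul_le_mul (h1 p) (h2 p) (norm_nonneg _) (by positivity)
    _ = _ := by field_simp; ring

theorem WeightBdd.smul_small {r : ℝ → ℝ → 𝕜} (hr : WeightBdd r) :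
    WeightSmall (fun ε p => ε • r ε p) := by
  obtain ⟨N, C, hC, hr⟩ := hr
  refine ⟨N, fun a ha => ?_⟩
  have h0 : ∀ᶠ ε : ℝ in 𝓝[≠] 0, |ε| < a / C := by
    have : Metric.ball (0 : ℝ) (a / C) ∈ 𝓝[≠] (0 : ℝ) :=
      nhdsWithin_le_nhds (Metric.ball_mem_nhds 0 (by positivity))
    filter_upwards [this] with ε hε using by simpa using hε
  filter_upwards [hr, h0] with ε h1 h2 p
  calc ‖ε • r ε p‖ ≤ a / C * (C * (1 + |p|) ^ N) := by
        rw [norm_smul, Real.norm_eq_abs]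
        exact mul_le_mul h2.le (h1 p) (norm_nonneg _) (by positivity)
    _ = _ := by field_simp

/-- Differentiable families that tend to zero together with their first derivatives. -/
def C1Small (r : ℝ → ℝ → 𝕜) : Prop :=
  (∀ ε, Differentiable ℝ (r ε)) ∧ WeightSmall r ∧ WeightSmall (fun ε => deriv (r ε))

/-- Differentiable families that are bounded together with their first derivatives. -/
def C1Bdd (r : ℝ → ℝ → 𝕜) : Prop :=
  (∀ ε, Differentiable ℝ (r ε)) ∧ WeightBdd r ∧ WeightBdd (fun ε => deriv (r ε))

theorem C1Small.bdd {r : ℝ → ℝ → 𝕜} (hr : C1Small r) : C1Bdd r :=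
  ⟨hr.1, hr.2.1.bdd, hr.2.2.bdd⟩

theorem C1Small.add {r s : ℝ → ℝ → 𝕜} (hr : C1Small r) (hs : C1Small s) :
    C1Small (fun ε p => r ε p + s ε p) := by
  refine ⟨fun ε => (hr.1 ε).add (hs.1 ε), hr.2.1.add hs.2.1, ?_⟩
  convert hr.2.2.add hs.2.2 using 3 with ε p
  exact deriv_add (hr.1 ε p) (hs.1 ε p)

theorem C1Bdd.add {r s : ℝ → ℝ → 𝕜} (hr : C1Bdd r) (hs : C1Bdd s) :
    C1Bdd (fun ε p => r ε p + s ε p) := by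
  refine ⟨fun ε => (hr.1 ε).add (hs.1 ε), hr.2.1.add hs.2.1, ?_⟩
  convert hr.2.2.add hs.2.2 using 3 with ε p
  exact deriv_add (hr.1 ε p) (hs.1 ε p)

theorem C1Bdd.mul {r s : ℝ → ℝ → 𝕜} (hr : C1Bdd r) (hs : C1Bdd s) :
    C1Bdd (fun ε p => r ε p * s ε p) := by
  refine ⟨fun ε => (hr.1 ε).mul (hs.1 ε), hr.2.1.mul hs.2.1, ?_⟩
  convert (hr.2.2.mul hs.2.1).add (hr.2.1.mul hs.2.2) using 3 with ε p
  exact deriv_mul (hr.1 ε p) (hs.1 ε p)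

theorem C1Small.mul_bdd {r s : ℝ → ℝ → 𝕜} (hr : C1Small r) (hs : C1Bdd s) :
    C1Small (fun ε p => r ε p * s ε p) := by
  refine ⟨fun ε => (hr.1 ε).mul (hs.1 ε), hr.2.1.mul_bdd hs.2.1, ?_⟩
  convert (hr.2.2.mul_bdd hs.2.1).add (hr.2.1.mul_bdd hs.2.2) using 3 with ε p
  exact deriv_mul (hr.1 ε p) (hs.1 ε p)

theorem C1Bdd.smul_small {r : ℝ → ℝ → 𝕜} (hr : C1Bdd r) :
    C1Small (fun ε p => ε • r ε p) := by
  refine ⟨fun ε => (hr.1 ε).const_smul ε, hr.2.1.smul_small, ?_⟩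
  convert hr.2.2.smul_small using 3 with ε p
  exact deriv_const_smul ε (hr.1 ε p)

theorem C1Bdd.const {h : ℝ → 𝕜} (hh : h.HasTemperateGrowth) : C1Bdd (fun _ => h) := by
  obtain ⟨N, C, hC, H⟩ := exists_growth hh
  have hle (p : ℝ) : C * (1 + |p|) ^ N ≤ (C + 1) * (1 + |p|) ^ N := by gcongr; simp
  exact ⟨fun _ => differentiable_of_temperate hh,
    ⟨N, C + 1, by positivity, Eventually.of_forall fun _ p => (H p).1.trans (hle p)⟩,
    ⟨N, C + 1, by positivity, Eventually.of_forall fun _ p => (H p).2.trans (hle p)⟩⟩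

theorem WeightSmall.congr {r s : ℝ → ℝ → 𝕜} (hr : WeightSmall r)
    (h : ∀ ε ≠ 0, ∀ p, s ε p = r ε p) : WeightSmall s := by
  obtain ⟨N, hr⟩ := hr
  refine ⟨N, fun a ha => ?_⟩
  filter_upwards [hr a ha, self_mem_nhdsWithin] with ε h1 h2 p
  rw [h ε h2]
  exact h1 p

/-- At `ε = 0` a difference quotient has only a default value (`0⁻¹ = 0`), so agreement is required
off zero and differentiability of `s` separately. -/
theorem C1Small.congr {r s : ℝ → ℝ → 𝕜} (hr : C1Small r) (hs : ∀ ε, Differentiable ℝ (s ε))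
    (h : ∀ ε ≠ 0, ∀ p, s ε p = r ε p) : C1Small s :=
  ⟨hs, hr.2.1.congr h, hr.2.2.congr fun ε hε p => by rw [show s ε = r ε from funext (h ε hε)]⟩

theorem WeightSmall.tendsto {r : ℝ → ℝ → 𝕜} (hr : WeightSmall r) (p : ℝ) :
    Tendsto (fun ε => r ε p) (𝓝[≠] 0) (𝓝 0) := by
  obtain ⟨N, hr⟩ := hr
  rw [Metric.tendsto_nhds]
  intro a ha
  have hw : 0 < (1 + |p|) ^ N := by positivity
  filter_upwards [hr (a / 2 / (1 + |p|) ^ N) (by positivity)] with ε h1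
  have := h1 p
  rw [div_mul_cancel₀ _ hw.ne'] at this
  rw [dist_zero_right]
  linarith

theorem exists_decay (Φ : 𝓢(ℝ, 𝕜)) (N : ℕ) : ∃ A, 0 < A ∧ ∀ x, (1 + |x|) ^ N * ‖Φ x‖ ≤ A := by
  have h := fun x => one_add_le_sup_seminorm_apply (𝕜 := 𝕜) (m := (N, 0)) le_rfl le_rfl Φ x
  simp only [norm_iteratedFDeriv_zero] at h
  refine ⟨_ + 1, ?_, fun x => (h x).trans (lt_add_one _).le⟩
  exact add_pos_of_nonneg_of_pos (le_trans (by positivity) (h 0)) one_pos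

/-- Continuity of `pv`: multiplication by a Schwartz function turns weighted C¹ smallness into the
two bounds required by `norm_pv_le`. This is why only orders 0 and 1 of `HasOMDeriv` are ever
needed. -/
theorem C1Small.tendsto_pv {r : ℝ → ℝ → 𝕜} (hr : C1Small r)
    (ht : ∀ ε, (r ε).HasTemperateGrowth) (Φ : 𝓢(ℝ, 𝕜)) (p : ℝ) :
    Tendsto (fun ε => pv (mS (r ε) Φ) p) (𝓝[≠] 0) (𝓝 0) := by
  obtain ⟨hd, ⟨N, h0⟩, ⟨M, h1⟩⟩ := hr
  -- The two extra powers absorb the factor `1 + x ^ 2` of the bound for `pv`.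
  obtain ⟨A, hA, H0⟩ := exists_decay Φ (N + 2)
  obtain ⟨B, hB, H1⟩ := exists_decay (dS Φ) N
  obtain ⟨D, hD, H2⟩ := exists_decay Φ M
  rw [Metric.tendsto_nhds]
  intro b hb
  set K := 4 * (1 + p ^ 2) * Real.pi with hK
  have hKpos : 0 < K := by positivity
  -- Chosen so that the final bound for `pv` is exactly `b / 2`.
  set a := b / (2 * K * (A + B + D)) with ha
  have hapos : 0 < a := by positivity
  filter_upwards [h0 a hapos, h1 a hapos] with ε e0 e1
  have b0 (x : ℝ) : (1 + x ^ 2) * ‖mS (r ε) Φ x‖ ≤ a * (A + B + D) := by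
    rw [mS_apply (ht ε), norm_mul]
    calc (1 + x ^ 2) * (‖r ε x‖ * ‖Φ x‖) ≤ (1 + |x|) ^ 2 * ((a * (1 + |x|) ^ N) * ‖Φ x‖) := by
          gcongr
          · rw [← sq_abs]; nlinarith [abs_nonneg x]
          · exact e0 x
      _ = a * ((1 + |x|) ^ (N + 2) * ‖Φ x‖) := by ring
      _ ≤ a * (A + B + D) := by gcongr; linarith [H0 x]
  have b1 (x : ℝ) : ‖deriv (mS (r ε) Φ) x‖ ≤ a * (A + B + D) := by
    rw [← dS_apply, dS_mS (ht ε), _root_.add_apply, mS_apply (hasTemperateGrowth_deriv (ht ε)),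
      mS_apply (ht ε)]
    calc _ ≤ ‖deriv (r ε) x‖ * ‖Φ x‖ + ‖r ε x‖ * ‖dS Φ x‖ := by
          rw [← norm_mul, ← norm_mul]; exact norm_add_le _ _
      _ ≤ (a * (1 + |x|) ^ M) * ‖Φ x‖ + (a * (1 + |x|) ^ N) * ‖dS Φ x‖ := by
          gcongr
          · exact e1 x
          · exact e0 x
      _ = a * ((1 + |x|) ^ M * ‖Φ x‖ + (1 + |x|) ^ N * ‖dS Φ x‖) := by ring
      _ ≤ a * (A + B + D) :=
          mul_le_mul_of_nonneg_left (by linarith [H1 x, H2 x]) hapos.le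
  rw [dist_zero_right]
  calc _ ≤ 4 * (a * (A + B + D)) * (1 + p ^ 2) * Real.pi := norm_pv_le b0 b1 p
    _ = b / 2 := by rw [ha, hK]; field_simp
    _ < b := by linarith

/-! ### Derivatives of curves -/

/-- The remainder of the difference quotient of a curve of functions. -/
def slopeRem (h : ℝ → ℝ → 𝕜) (h' : ℝ → 𝕜) (ε q : ℝ) : 𝕜 := ε⁻¹ • (h ε q - h 0 q) - h' q

/-- A differentiable curve of functions of temperate growth. -/
structure TemperateCurve (h : ℝ → ℝ → 𝕜) (h' : ℝ → 𝕜) : Prop where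
  temperate : ∀ ε, (h ε).HasTemperateGrowth
  temperate' : h'.HasTemperateGrowth
  small : C1Small (slopeRem h h')

theorem hasTemperateGrowth_slopeRem {h : ℝ → ℝ → 𝕜} {h' : ℝ → 𝕜}
    (hh : ∀ ε, (h ε).HasTemperateGrowth) (hh' : h'.HasTemperateGrowth) (ε : ℝ) :
    (slopeRem h h' ε).HasTemperateGrowth :=
  ((Function.HasTemperateGrowth.const ε⁻¹).smul ((hh ε).sub (hh 0))).sub hh'

theorem TemperateCurve.of_hasOMDeriv {h : ℝ → ℝ → 𝕜} {h' : ℝ → 𝕜}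
    (hh : ∀ ε, (h ε).HasTemperateGrowth) (hh' : h'.HasTemperateGrowth) (H : HasOMDeriv h h') :
    TemperateCurve h h' := by
  refine ⟨hh, hh',
    fun ε => differentiable_of_temperate (hasTemperateGrowth_slopeRem hh hh' ε), ?_, ?_⟩
  · have := H 0
    simp only [iteratedDeriv_zero] at this
    exact this
  · have := H 1
    simp only [iteratedDeriv_one] at this
    exact this

theorem eq_add_smul_slopeRem (h : ℝ → ℝ → 𝕜) (h' : ℝ → 𝕜) {ε : ℝ} (hε : ε ≠ 0) (q : ℝ) :
    h ε q = h 0 q + ε • (h' q + slopeRem h h' ε q) := by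
  rw [slopeRem, add_sub_cancel, smul_inv_smul₀ hε, add_sub_cancel]

theorem TemperateCurve.mul {h k : ℝ → ℝ → 𝕜} {h' k' : ℝ → 𝕜} (hh : TemperateCurve h h')
    (hk : TemperateCurve k k') :
    TemperateCurve (fun ε => h ε * k ε) (h' * k 0 + h 0 * k') := by
  have ht := fun ε => (hh.temperate ε).mul (hk.temperate ε)
  have ht' := (hh.temperate'.mul (hk.temperate 0)).add ((hh.temperate 0).mul hk.temperate')
  have s1 := hh.small.mul_bdd (C1Bdd.const (hk.temperate 0))
  have s2 := hk.small.mul_bdd (C1Bdd.const (hh.temperate 0))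
  -- The second-order term of the product: `ε` times the product of the two difference quotients.
  have s3 := (((C1Bdd.const hh.temperate').add hh.small.bdd).mul
    ((C1Bdd.const hk.temperate').add hk.small.bdd)).smul_small
  refine ⟨ht, ht', ((s1.add s2).add s3).congr
    (fun ε => differentiable_of_temperate (hasTemperateGrowth_slopeRem ht ht' ε)) fun ε hε p => ?_⟩
  have e1 := eq_add_smul_slopeRem h h' hε p
  have e2 := eq_add_smul_slopeRem k k' hε p
  rw [slopeRem]
  simp only [Pi.mul_apply, Pi.add_apply]
  rw [e1, e2]
  simp only [RCLike.real_smul_eq_coe_mul, RCLike.ofReal_inv]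
  have : (ε : 𝕜) ≠ 0 := RCLike.ofReal_ne_zero.2 hε
  field_simp
  ring

theorem hasDerivAt_zero_of_tendsto {u : ℝ → 𝕜} {u' : 𝕜} {v : ℝ → 𝕜}
    (h : ∀ ε ≠ 0, u ε = u 0 + ε • (u' + v ε)) (hv : Tendsto v (𝓝[≠] 0) (𝓝 0)) :
    HasDerivAt u u' 0 := by
  rw [hasDerivAt_iff_tendsto_slope]
  have := hv.const_add u'
  rw [add_zero] at this
  refine this.congr' ?_
  filter_upwards [self_mem_nhdsWithin] with ε hε
  rw [slope_def_module, sub_zero, h ε hε, add_sub_cancel_left, inv_smul_smul₀ hε]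

theorem TemperateCurve.hasDerivAt {h : ℝ → ℝ → 𝕜} {h' : ℝ → 𝕜} (hh : TemperateCurve h h')
    (p : ℝ) : HasDerivAt (fun ε => h ε p) (h' p) 0 :=
  hasDerivAt_zero_of_tendsto (fun _ hε => eq_add_smul_slopeRem h h' hε p) (hh.small.2.1.tendsto p)

theorem TemperateCurve.hasDerivAt_pv {h : ℝ → ℝ → 𝕜} {h' : ℝ → 𝕜} (hh : TemperateCurve h h')
    (Φ Ψ : 𝓢(ℝ, 𝕜)) (p : ℝ) :
    HasDerivAt (fun ε : ℝ => pv (mS (h ε) (Φ + ε • Ψ)) p)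
      (pv (mS h' Φ) p + pv (mS (h 0) Ψ) p) 0 := by
  have ht := hasTemperateGrowth_slopeRem hh.temperate hh.temperate'
  have t1 := hh.small.tendsto_pv ht Φ p
  have t2 := hh.small.tendsto_pv ht Ψ p
  have t3 : Tendsto (fun ε : ℝ => ε) (𝓝[≠] 0) (𝓝 0) := nhdsWithin_le_nhds
  have t4 := t1.add (t3.smul (t2.const_add (pv (mS h' Ψ) p)))
  rw [add_zero, zero_smul, add_zero] at t4
  refine hasDerivAt_zero_of_tendsto (fun ε hε => ?_) t4
  -- First-order expansion in `ε`; linearity of `pv` then reduces the remainder to `t1`, `t2` and a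
  -- constant times `ε`.
  have e : mS (h ε) (Φ + ε • Ψ) = mS (h 0) (Φ + (0 : ℝ) • Ψ)
      + (ε : 𝕜) • (mS h' Φ + mS (h 0) Ψ + (mS (slopeRem h h' ε) Φ
        + (ε : 𝕜) • (mS h' Ψ + mS (slopeRem h h' ε) Ψ))) := by
    ext q
    simp only [_root_.add_apply, _root_.smul_apply, mS_apply (hh.temperate ε),
      mS_apply (hh.temperate 0), mS_apply hh.temperate', mS_apply (ht ε),
      eq_add_smul_slopeRem h h' hε q, RCLike.real_smul_eq_coe_mul, smul_eq_mul]
    simp only [RCLike.ofReal_zero]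
    ring
  rw [e]
  simp only [← pvL_apply, map_add, map_smul, RCLike.real_smul_eq_coe_mul, smul_eq_mul]

theorem dS_add_smul (f Z : 𝓢(ℝ, 𝕜)) (ε : ℝ) : dS (f + ε • Z) = dS f + ε • dS Z := by
  have e (W : 𝓢(ℝ, 𝕜)) : ε • W = (ε : 𝕜) • W := by
    ext q
    simp only [_root_.smul_apply, RCLike.real_smul_eq_coe_mul, smul_eq_mul]
  rw [e, e, dS, map_add, map_smul]

theorem hasDerivAt_deriv_add_smul (f Z : 𝓢(ℝ, 𝕜)) (p : ℝ) :
    HasDerivAt (fun ε : ℝ => deriv (f + ε • Z : 𝓢(ℝ, 𝕜)) p) (deriv Z p) 0 := by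
  simp only [← dS_apply, dS_add_smul, _root_.add_apply, _root_.smul_apply]
  simpa using ((hasDerivAt_id (0 : ℝ)).smul_const (dS Z p)).const_add (dS f p)

theorem hasDerivAt_pv_add_smul (f Z : 𝓢(ℝ, 𝕜)) (p : ℝ) :
    HasDerivAt (fun ε : ℝ => pv (dS (f + ε • Z)) p) (pv (dS Z) p) 0 := by
  have e (ε : ℝ) : pv (dS (f + ε • Z)) p = pv (dS f) p + ε • pv (dS Z) p := by
    have : ε • dS Z = (ε : 𝕜) • dS Z := by
      ext q
      simp only [_root_.smul_apply, RCLike.real_smul_eq_coe_mul, smul_eq_mul]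
    rw [dS_add_smul, this]
    simp only [← pvL_apply, map_add, map_smul, RCLike.real_smul_eq_coe_mul, smul_eq_mul]
  simp only [e]
  simpa using ((hasDerivAt_id (0 : ℝ)).smul_const (pv (dS Z) p)).const_add (pv (dS f) p)

/-- The derivative of the coefficient of the product along a curve. -/
theorem hasDerivAt_coefProd {h k : ℝ → ℝ → 𝕜} {h' k' : ℝ → 𝕜} (hh : TemperateCurve h h')
    (hk : TemperateCurve k k') (f Z : 𝓢(ℝ, 𝕜)) (p : ℝ) :
    HasDerivAt (fun ε : ℝ => coefProd (f + ε • Z) (h ε) (k ε) p)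
      (k' p * pv (mS (h 0) (dS f)) p
        + k 0 p * (pv (mS h' (dS f)) p + pv (mS (h 0) (dS Z)) p)
        + (h' p * pv (mS (k 0) (dS f)) p
          + h 0 p * (pv (mS k' (dS f)) p + pv (mS (k 0) (dS Z)) p))
        - (pv (mS (h' * k 0 + h 0 * k') (dS f)) p + pv (mS (h 0 * k 0) (dS Z)) p)
        - ((h' p * k 0 p + h 0 p * k' p) * (1 + pv (dS f) p) + h 0 p * k 0 p * pv (dS Z) p)) 0 := by
  have d1 := hh.hasDerivAt_pv (dS f) (dS Z) p
  have d2 := hk.hasDerivAt_pv (dS f) (dS Z) p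
  have d3 := (hh.mul hk).hasDerivAt_pv (dS f) (dS Z) p
  have d4 := (hasDerivAt_pv_add_smul f Z p).const_add 1
  simp only [← dS_add_smul] at d1 d2 d3
  have := ((((hk.hasDerivAt p).mul d1).add ((hh.hasDerivAt p).mul d2)).sub d3).sub
    (((hh.hasDerivAt p).mul (hk.hasDerivAt p)).mul d4)
  simpa only [Pi.mul_apply, zero_smul, add_zero] using! this

/-- The covariant derivative of `c(g) g'` along `ζ f'` in terms of coefficients. -/
theorem covDeriv_eq {F : 𝓢(ℝ, 𝕜) → ℝ → 𝕜} {c : 𝓢(ℝ, 𝕜) → ℝ → 𝕜} {c' ζ : ℝ → 𝕜}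
    {f Z : 𝓢(ℝ, 𝕜)} (hF : ∀ g q, F g q = c g q * deriv g q) (hc : Differentiable ℝ (c f))
    (hc' : ∀ p, HasDerivAt (fun ε : ℝ => c (f + ε • Z) p) (c' p) 0) (hζ : Differentiable ℝ ζ)
    (hZ : ∀ q, Z q = ζ q * deriv f q) (p : ℝ) :
    HasDerivAt (fun ε : ℝ => F (f + ε • Z) p) (varDeriv F f Z p) 0 ∧
      covDeriv F f Z p = (c' p - ζ p * deriv (c f) p) * deriv f p := by
  have hd : HasDerivAt (fun ε : ℝ => F (f + ε • Z) p)
      (c' p * deriv f p + c f p * deriv Z p) 0 := by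
    simp only [hF]
    simpa using! (hc' p).mul (hasDerivAt_deriv_add_smul f Z p)
  have hv : varDeriv F f Z p = c' p * deriv f p + c f p * deriv Z p := hd.deriv
  refine ⟨hv ▸ hd, ?_⟩
  have hf : HasDerivAt (deriv f) (deriv (deriv f) p) p := by
    have : (deriv f : ℝ → 𝕜) = dS f := funext fun q => (dS_apply f q).symm
    rw [this]
    exact (dS f).differentiableAt.hasDerivAt
  have hZd : deriv Z p = deriv ζ p * deriv f p + ζ p * deriv (deriv f) p := by
    rw [show (Z : ℝ → 𝕜) = ζ * deriv f from funext hZ]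
    exact ((hζ p).hasDerivAt.mul hf).deriv
  have hch : christoffel f Z (F f) p = -((deriv ζ p * c f p + ζ p * deriv (c f) p) * deriv f p
      + ζ p * c f p * deriv (deriv f) p) := by
    simp only [christoffel, delta', delta, mul_div_deriv_eq hZ (hF f)]
    exact congrArg Neg.neg (((hζ p).hasDerivAt.mul (hc p).hasDerivAt).mul hf).deriv
  -- The terms with f'' and with the derivative of `ζ` cancel between the variation of g' and the
  -- Christoffel term.
  rw [covDeriv, hv, hch, hZd]
  ring

/-! ### Symmetry of the covariant derivative of the product -/

theorem mS_add_left {h k : ℝ → 𝕜} (hh : h.HasTemperateGrowth) (hk : k.HasTemperateGrowth)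
    (Φ : 𝓢(ℝ, 𝕜)) : mS (h + k) Φ = mS h Φ + mS k Φ := by
  rw [mS, smulLeftCLM_add hh hk, _root_.add_apply]

theorem mS_sub_left {h k : ℝ → 𝕜} (hh : h.HasTemperateGrowth) (hk : k.HasTemperateGrowth)
    (Φ : 𝓢(ℝ, 𝕜)) : mS (h - k) Φ = mS h Φ - mS k Φ := by
  rw [mS, smulLeftCLM_sub hh hk, _root_.sub_apply]

theorem mS_mS {h k : ℝ → 𝕜} (hh : h.HasTemperateGrowth) (hk : k.HasTemperateGrowth)
    (Φ : 𝓢(ℝ, 𝕜)) : mS h (mS k Φ) = mS (h * k) Φ :=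
  smulLeftCLM_smulLeftCLM_apply hh hk Φ

theorem hasDerivAt_coefProd_point (f : 𝓢(ℝ, 𝕜)) {h k : ℝ → 𝕜} (hh : h.HasTemperateGrowth)
    (hk : k.HasTemperateGrowth) (p : ℝ) :
    HasDerivAt (coefProd f h k)
      (deriv k p * pv (mS h (dS f)) p + k p * pv (dS (mS h (dS f))) p
        + (deriv h p * pv (mS k (dS f)) p + h p * pv (dS (mS k (dS f))) p)
        - pv (dS (mS (h * k) (dS f))) p
        - ((deriv h p * k p + h p * deriv k p) * (1 + pv (dS f) p)
          + h p * k p * pv (dS (dS f)) p)) p := by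
  have dh := (differentiable_of_temperate hh p).hasDerivAt
  have dk := (differentiable_of_temperate hk p).hasDerivAt
  exact (((dk.mul (hasDerivAt_pv (mS h (dS f)) p)).add (dh.mul (hasDerivAt_pv (mS k (dS f)) p))).sub
    (hasDerivAt_pv (mS (h * k) (dS f)) p)).sub
      ((dh.mul dk).mul ((hasDerivAt_pv (dS f) p).const_add 1))

/-- The coefficient of `(∇_Z c)(X, Y)` for `X = h f'`, `Y = k f'`, `Z = ζ f'`. -/
def covCoef (f : 𝓢(ℝ, 𝕜)) (ζ h k : ℝ → 𝕜) (p : ℝ) : 𝕜 :=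
  k p * pv (dS (mS (h * ζ) (dS f))) p + h p * pv (dS (mS (k * ζ) (dS f))) p
    - pv (dS (mS (h * k * ζ) (dS f))) p - h p * k p * pv (dS (mS ζ (dS f))) p
    - ζ p * k p * pv (dS (mS h (dS f))) p - ζ p * h p * pv (dS (mS k (dS f))) p
    + ζ p * pv (dS (mS (h * k) (dS f))) p + ζ p * h p * k p * pv (dS (dS f)) p

/-- The eight terms and signs are those of the expanded product of the increments of `h`, `k` and
`ζ`, in which the three functions play equal roles. -/
theorem covCoef_symm (f : 𝓢(ℝ, 𝕜)) (ζ h k : ℝ → 𝕜) (p : ℝ) :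
    covCoef f ζ h k p = covCoef f h ζ k p := by
  rw [covCoef, covCoef, mul_comm ζ h, mul_comm k h, mul_comm ζ k,
    show h * k * ζ = k * ζ * h by ring]
  ring

/-- A coefficient of a vector field at `f` together with its temperate curves. -/
theorem IsVectorFieldAt.exists_curve {X : 𝓢(ℝ, 𝕜) → 𝓢(ℝ, 𝕜)} {f : 𝓢(ℝ, 𝕜)}
    (hX : IsVectorFieldAt X f) :
    ∃ h : 𝓢(ℝ, 𝕜) → ℝ → 𝕜, (∀ g, (h g).HasTemperateGrowth) ∧
      (∀ g p, X g p = h g p * deriv g p) ∧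
      ∀ Z ∈ V f, ∃ h', TemperateCurve (fun ε : ℝ => h (f + ε • Z)) h' := by
  obtain ⟨h, hh, hX, hd⟩ := hX
  refine ⟨h, hh, hX, fun Z hZ => ?_⟩
  obtain ⟨h', ht, H⟩ := hd Z hZ
  exact ⟨h', TemperateCurve.of_hasOMDeriv (fun ε => hh _) ht H⟩

theorem coefProd_sub_left (f : 𝓢(ℝ, 𝕜)) {h h' k : ℝ → 𝕜} (hh : h.HasTemperateGrowth)
    (hh' : h'.HasTemperateGrowth) (hk : k.HasTemperateGrowth) (p : ℝ) :
    coefProd f (h - h') k p = coefProd f h k p - coefProd f h' k p := by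
  simp only [coefProd, sub_mul, mS_sub_left hh hh', mS_sub_left (hh.mul hk) (hh'.mul hk),
    ← pvL_apply, map_sub, Pi.sub_apply]
  ring

/-- The terms in `h'` and `k'` cancel by bilinearity. Those in `deriv h` and `deriv k` cancel
between the `p`-derivative of the product, the connection terms of the factors, and the Leibniz rule
applied under `pv`; only principal values of total derivatives remain. -/
theorem covCoef_eq (f : 𝓢(ℝ, 𝕜)) {ζ h k h' k' : ℝ → 𝕜} (hζ : ζ.HasTemperateGrowth)
    (hh : h.HasTemperateGrowth) (hk : k.HasTemperateGrowth) (hh' : h'.HasTemperateGrowth)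
    (hk' : k'.HasTemperateGrowth) (p : ℝ) :
    (k' p * pv (mS h (dS f)) p
        + k p * (pv (mS h' (dS f)) p + pv (mS h (dS (mS ζ (dS f)))) p)
        + (h' p * pv (mS k (dS f)) p
          + h p * (pv (mS k' (dS f)) p + pv (mS k (dS (mS ζ (dS f)))) p))
        - (pv (mS (h' * k + h * k') (dS f)) p + pv (mS (h * k) (dS (mS ζ (dS f)))) p)
        - ((h' p * k p + h p * k' p) * (1 + pv (dS f) p) + h p * k p * pv (dS (mS ζ (dS f))) p))
      - ζ p * deriv (coefProd f h k) p
      - coefProd f (h' - ζ * deriv h) k p - coefProd f h (k' - ζ * deriv k) p =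
    covCoef f ζ h k p := by
  have dh := hasTemperateGrowth_deriv hh
  have dk := hasTemperateGrowth_deriv hk
  -- The Leibniz rule, used to move the derivative in front of the whole product `u ζ f'`.
  have key {u : ℝ → 𝕜} (hu : u.HasTemperateGrowth) :
      pv (mS u (dS (mS ζ (dS f)))) p =
        pv (dS (mS (u * ζ) (dS f))) p - pv (mS (deriv u * ζ) (dS f)) p := by
    have e := dS_mS hu (mS ζ (dS f))
    rw [mS_mS hu hζ, mS_mS (hasTemperateGrowth_deriv hu) hζ] at e
    rw [e]
    simp only [← pvL_apply, map_add]
    ring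
  have ehk : deriv (h * k) = deriv h * k + h * deriv k :=
    funext fun q => deriv_mul (differentiable_of_temperate hh q) (differentiable_of_temperate hk q)
  have e3 : pv (mS (deriv (h * k) * ζ) (dS f)) p =
      pv (mS (ζ * deriv h * k) (dS f)) p + pv (mS (ζ * deriv k * h) (dS f)) p := by
    rw [ehk, show (deriv h * k + h * deriv k) * ζ = ζ * deriv h * k + ζ * deriv k * h by ring,
      mS_add_left ((hζ.mul dh).mul hk) ((hζ.mul dk).mul hh)]
    simp only [← pvL_apply, map_add]
  have e4 : pv (mS (h' * k + h * k') (dS f)) p =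
      pv (mS (h' * k) (dS f)) p + pv (mS (k' * h) (dS f)) p := by
    rw [mul_comm h k', mS_add_left (hh'.mul hk) (hk'.mul hh)]
    simp only [← pvL_apply, map_add]
  rw [coefProd_comm f h (k' - ζ * deriv k), coefProd_sub_left f hh' (hζ.mul dh) hk,
    coefProd_sub_left f hk' (hζ.mul dk) hh, (hasDerivAt_coefProd_point f hh hk p).deriv,
    key hh, key hk, key (hh.mul hk), e3, e4, mul_comm (deriv h), mul_comm (deriv k)]
  simp only [coefProd, covCoef, Pi.mul_apply]
  ring

theorem covDerivC_eq {X Y : 𝓢(ℝ, 𝕜) → 𝓢(ℝ, 𝕜)} {f Z : 𝓢(ℝ, 𝕜)}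
    {h k : 𝓢(ℝ, 𝕜) → ℝ → 𝕜} {h' k' ζ : ℝ → 𝕜} (hX : ∀ g p, X g p = h g p * deriv g p)
    (hY : ∀ g p, Y g p = k g p * deriv g p) (ht : ∀ g, (h g).HasTemperateGrowth)
    (kt : ∀ g, (k g).HasTemperateGrowth)
    (hh : TemperateCurve (fun ε : ℝ => h (f + ε • Z)) h')
    (hk : TemperateCurve (fun ε : ℝ => k (f + ε • Z)) k') (hζ : ζ.HasTemperateGrowth)
    (hZ : ∀ q, Z q = ζ q * deriv f q) (p : ℝ) :
    DifferentiableAt ℝ (fun ε : ℝ => prodField X Y (f + ε • Z) p) 0 ∧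
      covDerivC X Y f Z p = covCoef f ζ (h f) (k f) p * deriv f p := by
  have hF (g : 𝓢(ℝ, 𝕜)) (q : ℝ) : prodField X Y g q = coefProd g (h g) (k g) q * deriv g q :=
    cPair_eq (ht g) (kt g) (hX g) (hY g) q
  have hcX := fun q => (covDeriv_eq (F := fun g => X g) hX (differentiable_of_temperate (ht f))
    hh.hasDerivAt (differentiable_of_temperate hζ) hZ q).2
  have hcY := fun q => (covDeriv_eq (F := fun g => Y g) hY (differentiable_of_temperate (kt f))
    hk.hasDerivAt (differentiable_of_temperate hζ) hZ q).2
  obtain ⟨hd, hc⟩ := covDeriv_eq (F := prodField X Y) hF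
    (differentiable_of_temperate (hasTemperateGrowth_coefProd f (ht f) (kt f)))
    (hasDerivAt_coefProd hh hk f Z) (differentiable_of_temperate hζ) hZ p
  refine ⟨hd.differentiableAt, ?_⟩
  have hx := hh.temperate'.sub (hζ.mul (hasTemperateGrowth_deriv (ht f)))
  have hy := hk.temperate'.sub (hζ.mul (hasTemperateGrowth_deriv (kt f)))
  have hZS : Z = mS ζ (dS f) := DFunLike.coe_injective (eq_mS hζ hZ)
  rw [covDerivC, hc, cPair_eq hx (kt f) hcX (hY f), cPair_eq (ht f) hy (hX f) hcY,
    ← covCoef_eq f hζ (ht f) (kt f) hh.temperate' hk.temperate', ← hZS]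
  simp only [zero_smul, add_zero]
  ring

end DKP

end

theorem mainTheorem1 {𝕜 : Type*} [RCLike 𝕜] (f : 𝓢(ℝ, 𝕜)) :
    -- all the objects entering the kernel are well defined
    Differentiable ℝ (DKP.lam f) ∧
    (∀ (Φ : 𝓢(ℝ, 𝕜)) (p : ℝ), ∃ v, DKP.HasPV Φ p v) ∧
    (∀ X ∈ DKP.V f, ∀ Y ∈ DKP.V f,
      (∀ p, ∃ v, DKP.HasPV (fun q => X q * Y q / deriv f q) p v) ∧
      Integrable (fun p => X p * Y p / deriv f p)) ∧
    -- the kernel defines a bilinear product on `V`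
    (∃ m : DKP.V f →ₗ[𝕜] DKP.V f →ₗ[𝕜] DKP.V f,
      (∀ (X Y : DKP.V f) (p : ℝ),
        (m X Y : 𝓢(ℝ, 𝕜)) p = DKP.cPair f p (X : 𝓢(ℝ, 𝕜)) (Y : 𝓢(ℝ, 𝕜))) ∧
      -- symmetry
      (∀ X Y, m X Y = m Y X) ∧
      -- associativity, in both of its forms
      (∀ X Y Z, m (m X Y) Z = m X (m Y Z)) ∧
      (∀ X Y Z, m X (m Y Z) = m Y (m X Z)) ∧
      -- compatibility with the metric
      (∀ X Y Z : DKP.V f,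
        DKP.metric f (X : 𝓢(ℝ, 𝕜)) (m Y Z : 𝓢(ℝ, 𝕜)) =
          DKP.metric f (Y : 𝓢(ℝ, 𝕜)) (m X Z : 𝓢(ℝ, 𝕜)))) ∧
    -- compatibility with the connection
    (∀ X Y Z : 𝓢(ℝ, 𝕜) → 𝓢(ℝ, 𝕜), DKP.IsVectorFieldAt X f → DKP.IsVectorFieldAt Y f →
      DKP.IsVectorFieldAt Z f →
      (∃ W ∈ DKP.V f, ∀ p, HasDerivAt (fun ε : ℝ => X (f + ε • Z f) p)
          (DKP.varDeriv (fun g => X g) f (Z f) p) 0 ∧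
        W p = DKP.covDeriv (fun g => X g) f (Z f) p) ∧
      (∀ p, DifferentiableAt ℝ (fun ε : ℝ => DKP.prodField X Y (f + ε • Z f) p) 0) ∧
      (∀ p, DKP.covDerivC X Y f (Z f) p = DKP.covDerivC Z Y f (X f) p)) := by
  refine ⟨fun p => (DKP.hasDerivAt_lam f p).differentiableAt, fun Φ p => ⟨_, DKP.hasPV_pv Φ p⟩,
    ?_, ⟨DKP.mulV f, DKP.prodV_eq_cPair f, DKP.prodV_comm f, DKP.prodV_assoc f,
      DKP.prodV_left_comm f, DKP.metric_prodV_symm f⟩, ?_⟩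
  · rintro X ⟨h, hh, hX⟩ Y ⟨k, hk, hY⟩
    rw [DKP.mul_div_deriv_eq_mS hh hk hX hY]
    exact ⟨fun p => ⟨_, DKP.hasPV_pv _ p⟩, SchwartzMap.integrable _⟩
  · intro X Y Z hX hY hZ
    obtain ⟨h, ht, hX, hXd⟩ := hX.exists_curve
    obtain ⟨k, kt, hY, hYd⟩ := hY.exists_curve
    obtain ⟨z, zt, hZ, hZd⟩ := hZ.exists_curve
    have mX : X f ∈ DKP.V f := ⟨h f, ht f, hX f⟩
    have mZ : Z f ∈ DKP.V f := ⟨z f, zt f, hZ f⟩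
    -- The two sides need different directions: `X` and `Y` vary along `Z f` on the left, `Z` and
    -- `Y` along `X f` on the right. None of these derivatives survives in `covCoef`.
    obtain ⟨h', hh'⟩ := hXd _ mZ
    obtain ⟨k', hk'⟩ := hYd _ mZ
    obtain ⟨k₂, hk₂⟩ := hYd _ mX
    obtain ⟨z', hz'⟩ := hZd _ mX
    have hcov := DKP.covDerivC_eq hX hY ht kt hh' hk' (zt f) (hZ f)
    have hcov' := DKP.covDerivC_eq hZ hY zt kt hz' hk₂ (ht f) (hX f)
    have hder := DKP.covDeriv_eq (F := fun g => X g) hX (DKP.differentiable_of_temperate (ht f))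
      hh'.hasDerivAt (DKP.differentiable_of_temperate (zt f)) (hZ f)
    have hw := hh'.temperate'.sub ((zt f).mul (DKP.hasTemperateGrowth_deriv (ht f)))
    have hW (p : ℝ) : DKP.mS (h' - z f * deriv (h f)) (DKP.dS f) p =
        (h' - z f * deriv (h f)) p * deriv f p := by
      rw [DKP.mS_apply hw, DKP.dS_apply]
    refine ⟨⟨_, ⟨_, hw, hW⟩, fun p => ⟨(hder p).1, ?_⟩⟩, fun p => (hcov p).1, fun p => ?_⟩
    · rw [(hder p).2, hW]
      rfl
    · rw [(hcov p).2, (hcov' p).2, DKP.covCoef_symm]
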